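/- Let $(V,g)$ be a real vector space of dimension $2n$ with a positive definite metric. Let $\mathcal T(V,g)=\{J\in \mathrm{End}\,V : J^2=-1,\ g(J\cdot,J\cdot)=g(\cdot,\cdot)\}$, and for $J\in\mathcal T(V,g)$ let $U(J)=\{B\in O(V,g) : BJ=JB\}$, acting on $\mathcal T(V,g)$ by conjugation, $B\cdot K=BKB^{-1}$. For $J,K\in\mathcal T(V,g)$ and $\epsilon\in\mathbb R$ put $V_\epsilon=\mathrm{Ker}(JK+KJ-2\epsilon\mathbb 1)$. Suppose that $$V=V_{e_1}\oplus\dots\oplus V_{e_l}\oplus V_1\oplus V_{-1},\qquad e_i\in(-1,1),$$ where $\dim V_{e_i}=4k_i$, $\dim V_1=2m_1$ and $\dim V_{-1}=2m_{-1}$. Then $n=2k_1+\dots+2k_l+m_1+m_{-1}$, the orbit $U(J)\cdot K$ is an embedded submanifold of $\mathrm{End}\,V$, and $$U(J)\cdot K\;\cong\; U(n)/\bigl(Sp(k_1)\times\dots\times Sp(k_l)\times U(m_1)\times U(m_{-1})\bigr)$$ as smooth homogeneous spaces. Here $Sp(k)=U(2k)\cap Sp(2k,\mathbb C)$, the product is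 embedded in $U(n)$ as the group of block diagonal matrices with these blocks, and the quotient carries the smooth structure for which the projection from $U(n)$ is a smooth submersion; the isomorphism means that there are an isomorphism of Lie groups $\theta:U(n)\to U(J)$ and a diffeomorphism $\Phi$ from the quotient onto the orbit with $\Phi([h])=\theta(h)K\theta(h)^{-1}$ for all $h\in U(n)$. -/

import Mathlib

open scoped Manifold ContDiff InnerProductSpace Matrix.Norms.Elementwise

namespace Twistor

section TwistorSpace

variable {V : Type*} [NormedAddCommGroup V] [InnerProductSpace ℝ V]

/-- The twistor space of `(V, g)`: the orthogonal complex structures on `V`. The space `V` will be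
finite dimensional, so that `V →L[ℝ] V` is all of `End V`, with its usual topology. -/
def twistorSpace (V : Type*) [NormedAddCommGroup V] [InnerProductSpace ℝ V] :
    Set (V →L[ℝ] V) :=
  {J | J * J = -1 ∧ ∀ x y : V, ⟪J x, J y⟫_ℝ = ⟪x, y⟫_ℝ}

/-- `U(J)`: the orthogonal transformations of `V` that commute with `J`, as a subgroup of the
(topological) group of invertible endomorphisms of `V`. -/
def unitaryOf (J : V →L[ℝ] V) : Subgroup (V →L[ℝ] V)ˣ where
  carrier := {B | (∀ x y : V, ⟪(B : V →L[ℝ] V) x, (B : V →L[ℝ] V) y⟫_ℝ = ⟪x, y⟫_ℝ) ∧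
    (B : V →L[ℝ] V) * J = J * (B : V →L[ℝ] V)}
  one_mem' := ⟨fun _ _ => rfl, by simp⟩
  mul_mem' {A B} hA hB := by
    refine ⟨fun x y => ?_, ?_⟩
    · simp only [Units.val_mul, mul_apply_eq_comp]
      rw [hA.1, hB.1]
    · rw [Units.val_mul, mul_assoc, hB.2, ← mul_assoc, hA.2, mul_assoc]
  inv_mem' {B} hB := by
    have hc : ∀ x : V, (B : V →L[ℝ] V) (((B⁻¹ : (V →L[ℝ] V)ˣ) : V →L[ℝ] V) x) = x :=
        fun x => by
      rw [← mul_apply_eq_comp, Units.mul_inv, one_apply_eq_self]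
    refine ⟨fun x y => ?_, ?_⟩
    · rw [← hB.1, hc, hc]
    · rw [Units.inv_mul_eq_iff_eq_mul, ← mul_assoc, hB.2, mul_assoc, Units.mul_inv, mul_one]

/-- The orbit `U(J) · K` of `K` under conjugation, as a subset of `End V`. -/
def orbit (J K : V →L[ℝ] V) : Set (V →L[ℝ] V) :=
  Set.range fun B : unitaryOf J =>
    ((B : (V →L[ℝ] V)ˣ) : V →L[ℝ] V) * K * ((B : (V →L[ℝ] V)ˣ)⁻¹ : (V →L[ℝ] V)ˣ)

/-- `V_ε = Ker ({J, K} - 2 ε 1)`, where `{J, K} = J K + K J`. -/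
def eigenspace (J K : V →L[ℝ] V) (ε : ℝ) : Submodule ℝ V :=
  LinearMap.ker ((J * K + K * J - (2 * ε) • (1 : V →L[ℝ] V) : V →L[ℝ] V) : V →ₗ[ℝ] V)

/-- The family of subspaces `V_{e_1}, …, V_{e_l}, V_1, V_{-1}`. -/
def eigenspaces (J K : V →L[ℝ] V) {l : ℕ} (e : Fin l → ℝ) : Fin l ⊕ Fin 2 → Submodule ℝ V :=
  Sum.elim (fun i => eigenspace J K (e i)) ![eigenspace J K 1, eigenspace J K (-1)]

end TwistorSpace

section Groups

/-- The compact symplectic group `Sp(k) = U(2k) ∩ Sp(2k, ℂ)`, as a subgroup of `U(2k)`. -/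
def compactSp (k : ℕ) : Subgroup (Matrix.unitaryGroup (Fin k ⊕ Fin k) ℂ) where
  carrier := {A | (A : Matrix (Fin k ⊕ Fin k) (Fin k ⊕ Fin k) ℂ) ∈
    Matrix.symplecticGroup (Fin k) ℂ}
  one_mem' := one_mem (Matrix.symplecticGroup (Fin k) ℂ)
  mul_mem' hA hB := (Matrix.symplecticGroup (Fin k) ℂ).mul_mem hA hB
  inv_mem' {A} hA := by
    have h := (⟨A.1, hA⟩ : Matrix.symplecticGroup (Fin k) ℂ)⁻¹.2
    have h1 : (((⟨A.1, hA⟩ : Matrix.symplecticGroup (Fin k) ℂ)⁻¹ :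
        Matrix.symplecticGroup (Fin k) ℂ) : Matrix (Fin k ⊕ Fin k) (Fin k ⊕ Fin k) ℂ) * A.1 = 1 :=
      congrArg Subtype.val (inv_mul_cancel (⟨A.1, hA⟩ : Matrix.symplecticGroup (Fin k) ℂ))
    have h2 : A.1 * (A⁻¹).1 = 1 := congrArg Subtype.val (mul_inv_cancel A)
    rw [left_inv_eq_right_inv h1 h2] at h
    exact h

/-- Indices of rows and columns of a matrix with `l` diagonal blocks of sizes `2 k_1, …, 2 k_l`
followed by diagonal blocks of sizes `m₁` and `m₂`. -/
abbrev BlockIndex {l : ℕ} (k : Fin l → ℕ) (m₁ m₂ : ℕ) : Type :=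
  (Σ i : Fin l, Fin (k i) ⊕ Fin (k i)) ⊕ (Fin m₁ ⊕ Fin m₂)

variable {l n : ℕ} {k : Fin l → ℕ} {m₁ m₂ : ℕ}

/-- The block diagonal matrix `diag(A_1, …, A_l, B, C)`. -/
def blockMatrix (A : ∀ i, Matrix (Fin (k i) ⊕ Fin (k i)) (Fin (k i) ⊕ Fin (k i)) ℂ)
    (B : Matrix (Fin m₁) (Fin m₁) ℂ) (C : Matrix (Fin m₂) (Fin m₂) ℂ) :
    Matrix (BlockIndex k m₁ m₂) (BlockIndex k m₁ m₂) ℂ :=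
  Matrix.fromBlocks (Matrix.blockDiagonal' A) 0 0 (Matrix.fromBlocks B 0 0 C)

theorem blockMatrix_one : blockMatrix (k := k) (m₁ := m₁) (m₂ := m₂) (fun _ => 1) 1 1 = 1 := by
  have : (fun i => (1 : Matrix (Fin (k i) ⊕ Fin (k i)) (Fin (k i) ⊕ Fin (k i)) ℂ)) = 1 := rfl
  rw [blockMatrix, this, Matrix.blockDiagonal'_one, Matrix.fromBlocks_one, Matrix.fromBlocks_one]

theorem blockMatrix_mul
    (A A' : ∀ i, Matrix (Fin (k i) ⊕ Fin (k i)) (Fin (k i) ⊕ Fin (k i)) ℂ)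
    (B B' : Matrix (Fin m₁) (Fin m₁) ℂ) (C C' : Matrix (Fin m₂) (Fin m₂) ℂ) :
    blockMatrix (fun i => A i * A' i) (B * B') (C * C') =
      blockMatrix A B C * blockMatrix A' B' C' := by
  simp [blockMatrix, Matrix.fromBlocks_multiply, Matrix.blockDiagonal'_mul]

theorem blockMatrix_star
    (A : ∀ i, Matrix (Fin (k i) ⊕ Fin (k i)) (Fin (k i) ⊕ Fin (k i)) ℂ)
    (B : Matrix (Fin m₁) (Fin m₁) ℂ) (C : Matrix (Fin m₂) (Fin m₂) ℂ) :
    star (blockMatrix A B C) = blockMatrix (fun i => star (A i)) (star B) (star C) := by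
  simp [blockMatrix, Matrix.star_eq_conjTranspose, Matrix.fromBlocks_conjTranspose,
    Matrix.blockDiagonal'_conjTranspose]

/-- The block diagonal embedding
`Sp(k_1) × … × Sp(k_l) × U(m₁) × U(m₂) → U(n)`, `(A, B, C) ↦ diag(A_1, …, A_l, B, C)`,
where `ε` is an ordering of the `n = 2 k_1 + … + 2 k_l + m₁ + m₂` indices. -/
def blockHom (ε : BlockIndex k m₁ m₂ ≃ Fin n) :
    (∀ i, compactSp (k i)) × Matrix.unitaryGroup (Fin m₁) ℂ × Matrix.unitaryGroup (Fin m₂) ℂ →*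
      Matrix.unitaryGroup (Fin n) ℂ where
  toFun g := ⟨Matrix.reindex ε ε (blockMatrix (fun i => (g.1 i).1.1) g.2.1.1 g.2.2.1), by
    rw [Matrix.mem_unitaryGroup_iff, Matrix.star_eq_conjTranspose, Matrix.conjTranspose_reindex,
      ← Matrix.star_eq_conjTranspose, blockMatrix_star, Matrix.reindex_apply, Matrix.reindex_apply,
      Matrix.submatrix_mul_equiv, ← blockMatrix_mul,
      Matrix.mem_unitaryGroup_iff.1 g.2.1.2, Matrix.mem_unitaryGroup_iff.1 g.2.2.2,
      funext fun i => Matrix.mem_unitaryGroup_iff.1 (g.1 i).1.2, blockMatrix_one,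
      Matrix.submatrix_one_equiv]⟩
  map_one' := Subtype.ext (by
    change Matrix.reindex ε ε (blockMatrix (fun _ => 1) 1 1) = 1
    rw [blockMatrix_one, Matrix.reindex_apply, Matrix.submatrix_one_equiv])
  map_mul' g h := Subtype.ext (by
    change Matrix.reindex ε ε (blockMatrix (fun i => (g.1 i).1.1 * (h.1 i).1.1)
      (g.2.1.1 * h.2.1.1) (g.2.2.1 * h.2.2.1)) = Matrix.reindex ε ε _ * Matrix.reindex ε ε _
    rw [blockMatrix_mul, Matrix.reindex_apply, Matrix.reindex_apply, Matrix.reindex_apply,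
      Matrix.submatrix_mul_equiv])

/-- The subgroup `Sp(k_1) × … × Sp(k_l) × U(m₁) × U(m₂)` of `U(n)`, block diagonally embedded. -/
def blockSubgroup (ε : BlockIndex k m₁ m₂ ≃ Fin n) : Subgroup (Matrix.unitaryGroup (Fin n) ℂ) :=
  (blockHom ε).range

end Groups

section Manifolds

/-- A smooth structure of dimension `d` on a subspace `X` of a normed space `E`, with inclusion map
`incl`, makes `X` an embedded submanifold of `E`. For a given `X`, such a structure is
unique up to equivalence of atlases. -/
def IsEmbeddedSubmanifold {X E : Type*} [TopologicalSpace X] [NormedAddCommGroup E]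
    [NormedSpace ℝ E] (d : ℕ) [ChartedSpace (EuclideanSpace ℝ (Fin d)) X] (incl : X → E) : Prop :=
  IsManifold (𝓡 d) ∞ X ∧ Manifold.IsSmoothEmbedding (𝓡 d) 𝓘(ℝ, E) ∞ incl

/-- A smooth structure of dimension `d` on `G ⧸ H`, with the quotient topology, is the quotient
smooth structure: the projection `G → G ⧸ H` is a smooth submersion. For a given smooth structure
on `G`, such a structure is unique up to equivalence of atlases. -/
def IsQuotientManifold {G : Type*} [Group G] [TopologicalSpace G] (c : ℕ)
    [ChartedSpace (EuclideanSpace ℝ (Fin c)) G] (H : Subgroup G) (d : ℕ)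
    [ChartedSpace (EuclideanSpace ℝ (Fin d)) (G ⧸ H)] : Prop :=
  IsManifold (𝓡 d) ∞ (G ⧸ H) ∧
    Manifold.IsSubmersion (𝓡 c) (𝓡 d) ∞ (QuotientGroup.mk : G → G ⧸ H)

end Manifolds

end Twistor

/-!
A unitary frame of `(V, J)` identifies `V` with `ℂ^n` and `U(J)` with `U(n)`. On `V_ε` with
`|ε| < 1`, the operator `K + ε J` anticommutes with `J` and has square `-(1 - ε²)`, so that after
rescaling it is a second complex structure which makes `V_ε` quaternionic; on `V_{±1}`, `K = ∓J`.
In a frame adapted to this structure, `B ∈ U(J)` commutes with `K` if and only if its matrix is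
block diagonal (it preserves the eigenspaces of `J K + K J`) and each of its first `l` blocks
commutes with `z ↦ J z̄`, i.e. is symplectic: the stabilizer of `K` is
`Sp(k_1) × … × Sp(k_l) × U(m₁) × U(m₂)`.

The smooth structures come from the exponential map. For a compact group of units of a
finite-dimensional algebra acting linearly, the group near `1` is the exponential of its Lie
algebra, the stabilizer is the exponential of the kernel of the infinitesimal action, and a
complement of that kernel parametrizes both the quotient near the base point and the orbit.
-/

namespace Twistor

section Slices

open Set Topology

variable {E E' F F' N N' : Type*} [NormedAddCommGroup E] [NormedSpace ℝ E]
  [NormedAddCommGroup E'] [NormedSpace ℝ E'] [NormedAddCommGroup F] [NormedSpace ℝ F]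
  [NormedAddCommGroup F'] [NormedSpace ℝ F'] [NormedAddCommGroup N] [NormedSpace ℝ N]
  [NormedAddCommGroup N'] [NormedSpace ℝ N']

/-- A partial diffeomorphism from `F × N` to `E` which straightens the subset `S` of `E` to
`F × {0}`: the inverse of a slice chart of `S`. -/
structure SlicePatch (S : Set E) (F N : Type*) [NormedAddCommGroup F] [NormedSpace ℝ F]
    [NormedAddCommGroup N] [NormedSpace ℝ N] extends OpenPartialHomeomorph (F × N) E where
  contDiffOn : ContDiffOn ℝ ∞ toOpenPartialHomeomorph source
  contDiffOn_symm : ContDiffOn ℝ ∞ toOpenPartialHomeomorph.symm target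
  apply_mem_iff : ∀ p ∈ source, toOpenPartialHomeomorph p ∈ S ↔ p.2 = 0

namespace SlicePatch

variable {S : Set E} {S' : Set E'}

instance : CoeFun (SlicePatch S F N) fun _ => F × N → E := ⟨fun P => P.toOpenPartialHomeomorph⟩

theorem symm_snd_eq_zero (P : SlicePatch S F N) {y : E} (hy : y ∈ P.target) (hS : y ∈ S) :
    (P.symm y).2 = 0 := by
  rwa [← P.apply_mem_iff _ (P.map_target hy), P.right_inv hy]

theorem apply_symm_fst_zero (P : SlicePatch S F N) {y : E} (hy : y ∈ P.target) (hS : y ∈ S) :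
    P ((P.symm y).1, 0) = y := by
  rw [← P.symm_snd_eq_zero hy hS, Prod.mk.eta, P.right_inv hy]

/-- The slice patch obtained by linear changes of the coordinates along `S` and of the ambient
space. -/
def congr (P : SlicePatch S F N) (e : F' ≃L[ℝ] F) (T : E ≃L[ℝ] E') (hT : ∀ y, T y ∈ S' ↔ y ∈ S) :
    SlicePatch S' F' N where
  toOpenPartialHomeomorph :=
    ((e.prodCongr (.refl ℝ N)).toHomeomorph.transOpenPartialHomeomorph
      P.toOpenPartialHomeomorph).transHomeomorph T.toHomeomorph
  contDiffOn := T.contDiff.comp_contDiffOn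
    (P.contDiffOn.comp (e.prodCongr (.refl ℝ N)).contDiff.contDiffOn fun _ hp => hp)
  contDiffOn_symm := (e.prodCongr (.refl ℝ N)).symm.contDiff.comp_contDiffOn
    (P.contDiffOn_symm.comp T.symm.contDiff.contDiffOn fun _ hy => hy)
  apply_mem_iff _ hp := (hT _).trans (P.apply_mem_iff _ hp)

theorem mem_congr_target (P : SlicePatch S F N) (e : F' ≃L[ℝ] F) (T : E ≃L[ℝ] E')
    (hT : ∀ y, T y ∈ S' ↔ y ∈ S) {y : E'} :
    y ∈ (P.congr e T hT).target ↔ T.symm y ∈ P.target := Iff.rfl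

section chart

variable {X : Type*} [TopologicalSpace X] [Nonempty X] {i : X → E} (hi : IsEmbedding i)
  (hr : range i = S) (P : SlicePatch S F N)

/-- The chart defined by a slice patch of `S` on a space `X` embedded into `E` with image `S`. -/
noncomputable def chart : OpenPartialHomeomorph X F where
  toFun x := (P.symm (i x)).1
  invFun z := Function.invFun i (P (z, 0))
  source := i ⁻¹' P.target
  target := (fun z : F => (z, (0 : N))) ⁻¹' P.source
  map_source' x hx := by
    have := P.map_target hx
    rwa [← Prod.mk.eta (p := P.symm (i x)),
      P.symm_snd_eq_zero hx (hr.subset (mem_range_self x))] at this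
  map_target' z hz := by
    have h : P (z, 0) ∈ range i := hr ▸ (P.apply_mem_iff _ hz).2 rfl
    simpa only [mem_preimage, Function.invFun_eq h] using P.map_source hz
  left_inv' x hx := by
    rw [P.apply_symm_fst_zero hx (hr.subset (mem_range_self x)),
      Function.leftInverse_invFun hi.injective]
  right_inv' z hz := by
    have h : P (z, 0) ∈ range i := hr ▸ (P.apply_mem_iff _ hz).2 rfl
    rw [Function.invFun_eq h, P.left_inv hz]
  open_source := P.open_target.preimage hi.continuous
  open_target := P.open_source.preimage (by fun_prop)
  continuousOn_toFun := continuous_fst.comp_continuousOn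
    (P.continuousOn_symm.comp hi.continuous.continuousOn fun _ h => h)
  continuousOn_invFun := by
    rw [hi.continuousOn_iff]
    refine ContinuousOn.congr (f := fun z => P (z, 0)) ?_ fun z hz =>
      Function.invFun_eq (hr ▸ (P.apply_mem_iff _ hz).2 rfl)
    exact P.continuousOn.comp (by fun_prop) fun _ h => h

theorem chart_apply (x : X) : P.chart hi hr x = (P.symm (i x)).1 := rfl

theorem mem_chart_source {x : X} : x ∈ (P.chart hi hr).source ↔ i x ∈ P.target := Iff.rfl

theorem apply_chart_symm {z : F} (hz : z ∈ (P.chart hi hr).target) :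
    i ((P.chart hi hr).symm z) = P (z, 0) :=
  Function.invFun_eq (hr ▸ (P.apply_mem_iff _ hz).2 rfl)

end chart

theorem symm_trans_mem_maximalAtlas (P : SlicePatch S F N) (e : (F × N) ≃L[ℝ] E) :
    P.symm.trans e.toHomeomorph.toOpenPartialHomeomorph ∈
      IsManifold.maximalAtlas 𝓘(ℝ, E) ∞ E := by
  refine StructureGroupoid.mem_maximalAtlas_of_mem_groupoid _ ?_
  rw [contDiffGroupoid, mem_groupoid_of_pregroupoid]
  constructor
  · have : ContDiffOn ℝ ∞ (e ∘ P.symm) P.target :=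
      e.contDiff.comp_contDiffOn P.contDiffOn_symm
    simpa [contDiffPregroupoid] using this
  · have : ContDiffOn ℝ ∞ (P ∘ e.symm) (e.symm ⁻¹' P.source) :=
      P.contDiffOn.comp e.symm.contDiff.contDiffOn fun _ h => h
    simpa [contDiffPregroupoid] using this

end SlicePatch

/-- A family of slice patches whose images cover `S`, together with a linear identification of the
ambient space with their model space. -/
structure SliceAtlas (S : Set E) (A F N : Type*) [NormedAddCommGroup F] [NormedSpace ℝ F]
    [NormedAddCommGroup N] [NormedSpace ℝ N] where
  equiv : (F × N) ≃L[ℝ] E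
  patch : A → SlicePatch S F N
  cover : ∀ y ∈ S, ∃ a, y ∈ (patch a).target

namespace SliceAtlas

/-- The slice atlas formed by the images of a single slice patch under linear isomorphisms which
carry `S` onto `S'`. -/
def ofTranslates {S : Set E} {S' : Set E'} {A : Type*} (P : SlicePatch S F N) (h0 : 0 ∈ P.source)
    (e : F' ≃L[ℝ] F) (T : A → E ≃L[ℝ] E') (hT : ∀ a y, T a y ∈ S' ↔ y ∈ S)
    (hcover : ∀ y ∈ S', ∃ a, T a (P 0) = y) (L : (F' × N) ≃L[ℝ] E') : SliceAtlas S' A F' N where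
  equiv := L
  patch a := P.congr e (T a) (hT a)
  cover y hy := by
    obtain ⟨a, ha⟩ := hcover y hy
    refine ⟨a, ?_⟩
    rw [P.mem_congr_target, ← ha, ContinuousLinearEquiv.symm_apply_apply]
    exact P.map_source h0

variable {S : Set E} {A : Type*} (s : SliceAtlas S A F N)
  {X : Type*} [TopologicalSpace X] [Nonempty X] {i : X → E} (hi : IsEmbedding i)
  (hr : range i = S)

/-- The charts defined by a slice atlas of `S` on a space `X` embedded into `E` with image `S`. -/
@[reducible]
noncomputable def chartedSpace : ChartedSpace F X where
  atlas := range fun a => (s.patch a).chart hi hr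
  chartAt x := (s.patch (s.cover (i x) (hr.subset (mem_range_self x))).choose).chart hi hr
  mem_chart_source x := (s.cover (i x) (hr.subset (mem_range_self x))).choose_spec
  chart_mem_atlas _ := mem_range_self _

theorem isManifold :
    letI := s.chartedSpace hi hr
    IsManifold 𝓘(ℝ, F) ∞ X := by
  let _ := s.chartedSpace hi hr
  refine isManifold_of_contDiffOn _ _ _ ?_
  rintro _ _ ⟨a, rfl⟩ ⟨b, rfl⟩
  simp only [modelWithCornersSelf_coe, Function.id_comp, modelWithCornersSelf_coe_symm,
    Function.comp_id, preimage_id, range_id, inter_univ, OpenPartialHomeomorph.coe_trans]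
  have key : ContDiffOn ℝ ∞ (fun z : F => ((s.patch b).symm (s.patch a (z, 0))).1)
      (((s.patch a).chart hi hr).symm.trans ((s.patch b).chart hi hr)).source := by
    refine contDiff_fst.comp_contDiffOn ((s.patch b).contDiffOn_symm.comp
      ((s.patch a).contDiffOn.comp (contDiff_id.prodMk contDiff_const).contDiffOn ?_) ?_)
    · exact fun z hz => hz.1
    · intro z hz
      have h : i (((s.patch a).chart hi hr).symm z) ∈ (s.patch b).target := hz.2
      rwa [SlicePatch.apply_chart_symm hi hr _ hz.1] at h
  refine key.congr fun z hz => ?_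
  rw [Function.comp_apply, SlicePatch.chart_apply, SlicePatch.apply_chart_symm hi hr _ hz.1]

theorem chart_mem_maximalAtlas (a : A) :
    letI := s.chartedSpace hi hr
    (s.patch a).chart hi hr ∈ IsManifold.maximalAtlas 𝓘(ℝ, F) ∞ X := by
  let _ := s.chartedSpace hi hr
  have := s.isManifold hi hr
  exact IsManifold.subset_maximalAtlas (mem_range_self a)

theorem isSmoothEmbedding :
    letI := s.chartedSpace hi hr
    Manifold.IsSmoothEmbedding 𝓘(ℝ, F) 𝓘(ℝ, E) ∞ i := by
  let _ := s.chartedSpace hi hr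
  have := s.isManifold hi hr
  refine ⟨Manifold.IsImmersionOfComplement.isImmersion (F := N) fun x => ?_, hi⟩
  obtain ⟨a, ha⟩ := s.cover (i x) (hr.subset (mem_range_self x))
  refine Manifold.IsImmersionAtOfComplement.mk_of_charts s.equiv ((s.patch a).chart hi hr)
    ((s.patch a).symm.trans s.equiv.toHomeomorph.toOpenPartialHomeomorph) ha ?_
    (s.chart_mem_maximalAtlas hi hr a) ((s.patch a).symm_trans_mem_maximalAtlas s.equiv) ?_ ?_
  · simpa using ha
  · intro y hy
    simpa using (SlicePatch.mem_chart_source hi hr _).1 hy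
  · intro z hz
    have hz' : z ∈ ((s.patch a).chart hi hr).target := by simpa using hz
    have : (s.patch a).symm (i (((s.patch a).chart hi hr).symm z)) = (z, 0) := by
      rw [SlicePatch.apply_chart_symm hi hr _ hz', (s.patch a).left_inv hz']
    simpa using this

theorem exists_diffeomorph {Y : Type*} [TopologicalSpace Y] [Nonempty Y] {j : Y → E}
    (hj : IsEmbedding j) (hr' : range j = S) :
    letI := s.chartedSpace hi hr
    letI := s.chartedSpace hj hr'
    ∃ Φ : Diffeomorph 𝓘(ℝ, F) 𝓘(ℝ, F) X Y ∞, ∀ x, j (Φ x) = i x := by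
  let _ := s.chartedSpace hi hr
  let _ := s.chartedSpace hj hr'
  have hXi := s.isSmoothEmbedding hi hr
  have hYj := s.isSmoothEmbedding hj hr'
  have := s.isManifold hi hr
  have := s.isManifold hj hr'
  let φ : X ≃ₜ Y :=
    hi.toHomeomorph.trans ((Homeomorph.setCongr (hr.trans hr'.symm)).trans hj.toHomeomorph.symm)
  have hφ (x : X) : j (φ x) = i x :=
    congrArg Subtype.val (hj.toHomeomorph.apply_symm_apply _)
  have hφ' (y : Y) : i (φ.symm y) = j y := by rw [← hφ, φ.apply_symm_apply]
  refine ⟨⟨φ.toEquiv, ?_, ?_⟩, hφ⟩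
  · refine (ContMDiff.iff_comp_isImmersion hYj.isImmersion).2 ⟨φ.continuous, ?_⟩
    exact hXi.contMDiff.congr hφ
  · refine (ContMDiff.iff_comp_isImmersion hXi.isImmersion).2 ⟨φ.symm.continuous, ?_⟩
    exact hYj.contMDiff.congr hφ'

theorem isSubmersion {S' : Set E'} (t : SliceAtlas S' A F' N') {Y : Type*} [TopologicalSpace Y]
    [Nonempty Y] {j : Y → E'} (hj : IsEmbedding j) (hr' : range j = S') {f : X → Y}
    {C : Type*} [NormedAddCommGroup C] [NormedSpace ℝ C] (q : F ≃L[ℝ] F' × C)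
    (hsource : ∀ a z, (z, 0) ∈ (s.patch a).source → ((q z).1, 0) ∈ (t.patch a).source)
    (hf : ∀ a z, (z, 0) ∈ (s.patch a).source → ∀ x, i x = s.patch a (z, 0) →
      j (f x) = t.patch a ((q z).1, 0)) :
    letI := s.chartedSpace hi hr
    letI := t.chartedSpace hj hr'
    Manifold.IsSubmersion 𝓘(ℝ, F) 𝓘(ℝ, F') ∞ f := by
  let _ := s.chartedSpace hi hr
  let _ := t.chartedSpace hj hr'
  have hfx (a : A) (x : X) (hx : i x ∈ (s.patch a).target) :
      j (f x) = t.patch a ((q ((s.patch a).symm (i x)).1).1, 0) ∧ j (f x) ∈ (t.patch a).target := by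
    have hz := ((s.patch a).chart hi hr).map_source hx
    have h := hf a _ hz x ((s.patch a).apply_symm_fst_zero hx (hr.subset (mem_range_self x))).symm
    exact ⟨h, h ▸ (t.patch a).map_source (hsource a _ hz)⟩
  refine Manifold.IsSubmersionOfComplement.isSubmersion (F := C) fun x => ?_
  obtain ⟨a, ha⟩ := s.cover (i x) (hr.subset (mem_range_self x))
  refine Manifold.IsSubmersionAtOfComplement.mk_of_charts q ((s.patch a).chart hi hr)
    ((t.patch a).chart hj hr') ha (hfx a x ha).2 (s.chart_mem_maximalAtlas hi hr a)
    (t.chart_mem_maximalAtlas hj hr' a) (fun y hy => (hfx a y hy).2) fun z hz => ?_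
  have hz' : z ∈ ((s.patch a).chart hi hr).target := by simpa using hz
  have h := hf a z hz' _ (SlicePatch.apply_chart_symm hi hr _ hz')
  have : (t.patch a).chart hj hr' (f (((s.patch a).chart hi hr).symm z)) = (q z).1 := by
    rw [SlicePatch.chart_apply, h, (t.patch a).left_inv (hsource a z hz')]
  simpa using this

end SliceAtlas

end Slices

section ExponentialCoordinates

open Set Topology NormedSpace

section InverseFunction

variable {E F N : Type*} [NormedAddCommGroup E] [NormedSpace ℝ E] [NormedAddCommGroup F]
  [NormedSpace ℝ F] [NormedAddCommGroup N] [NormedSpace ℝ N]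

/-- The inverse function theorem also provides smoothness of the inverse away from the base point,
because the derivative remains invertible nearby. -/
theorem exists_openPartialHomeomorph [CompleteSpace E] {f : E → F} (hf : ContDiff ℝ ∞ f) {a : E}
    {f' : E ≃L[ℝ] F} (hf' : HasFDerivAt f (f' : E →L[ℝ] F) a) {U : Set E} (hU : U ∈ 𝓝 a) :
    ∃ P : OpenPartialHomeomorph E F, a ∈ P.source ∧ P.source ⊆ U ∧ (∀ x, P x = f x) ∧
      ContDiffOn ℝ ∞ P.symm P.target := by
  have hn : (∞ : WithTop ℕ∞) ≠ 0 := by simp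
  let W : Set E := fderiv ℝ f ⁻¹' range ((↑) : (E ≃L[ℝ] F) → E →L[ℝ] F)
  have hW : IsOpen W := ContinuousLinearEquiv.isOpen.preimage (hf.continuous_fderiv hn)
  let P := (hf.contDiffAt.toOpenPartialHomeomorph f hf' hn).restrOpen (W ∩ interior U)
    (hW.inter isOpen_interior)
  refine ⟨P, ⟨hf.contDiffAt.mem_toOpenPartialHomeomorph_source hf' hn, ⟨f', hf'.fderiv.symm⟩,
    mem_interior_iff_mem_nhds.2 hU⟩, fun x hx => interior_subset hx.2.2, fun _ => rfl,
    fun y hy => ?_⟩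
  obtain ⟨g, hg⟩ := (P.map_target hy).2.1
  have hderiv : HasFDerivAt f (g : E →L[ℝ] F) (P.symm y) := by
    rw [hg]
    exact (hf.differentiable hn _).hasFDerivAt
  exact (P.contDiffAt_symm hy hderiv hf.contDiffAt).contDiffWithinAt

theorem exists_slicePatch [CompleteSpace (F × N)] {S : Set E} {f : F × N → E}
    (hf : ContDiff ℝ ∞ f) {f' : (F × N) ≃L[ℝ] E} (hf' : HasFDerivAt f (f' : F × N →L[ℝ] E) 0)
    (hS : ∀ᶠ p in 𝓝 0, f p ∈ S ↔ p.2 = 0) {U : Set (F × N)} (hU : U ∈ 𝓝 0) :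
    ∃ P : SlicePatch S F N, 0 ∈ P.source ∧ P.source ⊆ U ∧ ∀ p, P p = f p := by
  obtain ⟨P, h0, hPU, hP, hP'⟩ := exists_openPartialHomeomorph hf hf' (Filter.inter_mem hS hU)
  have hPf : (P : F × N → E) = f := funext hP
  exact ⟨⟨P, hPf ▸ hf.contDiffOn, hP', fun p hp => hPf ▸ (hPU hp).1⟩, h0, fun p hp => (hPU hp).2,
    hP⟩

end InverseFunction

section Unitary

theorem one_add_mem_unitary_iff {A : Type*} [Ring A] [StarRing A] {w : A} (hw : IsSelfAdjoint w)
    (h : IsUnit (2 + w)) : 1 + w ∈ unitary A ↔ w = 0 := by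
  refine ⟨fun hmem => ?_, fun h0 => by simp [h0]⟩
  have hsq := (Unitary.mem_iff.1 hmem).1
  rw [star_add, star_one, hw.star_eq] at hsq
  have hprod : w * (2 + w) = 0 := by
    rw [← sub_eq_zero.2 hsq]
    noncomm_ring
  exact h.mul_left_eq_zero.1 hprod

variable {A : Type*} [NormedRing A] [NormedAlgebra ℝ A]

theorem contDiff_exp [CompleteSpace A] : ContDiff ℝ ∞ (exp : A → A) :=
  contDiff_iff_contDiffAt.2 fun x => (exp_analytic (𝕂 := ℝ) x).contDiffAt

theorem hasFDerivAt_exp_comp [CompleteSpace A] {E : Type*} [NormedAddCommGroup E]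
    [NormedSpace ℝ E] (T : E →L[ℝ] A) : HasFDerivAt (fun x => exp (T x)) T 0 := by
  have h : HasFDerivAt (exp : A → A) (1 : A →L[ℝ] A) (T 0) := by
    rw [map_zero]
    exact hasFDerivAt_exp_zero
  exact h.comp 0 T.hasFDerivAt

variable [StarRing A]

theorem isCompact_unitary [CStarRing A] [FiniteDimensional ℝ A] :
    IsCompact (unitary A : Set A) := by
  have := FiniteDimensional.proper_real A
  refine Metric.isCompact_of_isClosed_isBounded isClosed_unitary ?_
  refine isBounded_iff_forall_norm_le.2 ⟨1, fun u hu => ?_⟩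
  cases subsingleton_or_nontrivial A
  · simp [Subsingleton.elim u 0]
  · exact (CStarRing.norm_of_mem_unitary hu).le

variable [StarModule ℝ A]

theorem isCompl_skewAdjoint_selfAdjoint :
    IsCompl (skewAdjoint.submodule ℝ A) (selfAdjoint.submodule ℝ A) := by
  refine IsCompl.of_eq ?_ ?_
  · refine (Submodule.eq_bot_iff _).2 fun x hx => ?_
    have h : x = -x := (selfAdjoint.mem_iff.1 hx.2).symm.trans (skewAdjoint.mem_iff.1 hx.1)
    have : IsAddTorsionFree A := .of_isTorsionFree ℝ A
    exact self_eq_neg.1 h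
  · refine Submodule.eq_top_iff'.2 fun x => ?_
    rw [← StarModule.selfAdjointPart_add_skewAdjointPart ℝ x, add_comm]
    exact Submodule.add_mem_sup (skewAdjointPart ℝ x).2 (selfAdjointPart ℝ x).2

theorem exp_mem_unitary [CompleteSpace A] [ContinuousStar A] (X : skewAdjoint.submodule ℝ A) :
    exp (X : A) ∈ unitary A :=
  let _ : NormedAlgebra ℚ A := NormedAlgebra.restrictScalars ℚ ℝ A
  exp_mem_unitary_of_mem_skewAdjoint X.2

end Unitary

section GroupPatch

variable {A : Type*} [NormedRing A] [NormedAlgebra ℝ A] [StarRing A] [StarModule ℝ A]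
  {F F' : Type*} [NormedAddCommGroup F] [NormedSpace ℝ F] [NormedAddCommGroup F'] [NormedSpace ℝ F']
  (e : (F × F') ≃L[ℝ] skewAdjoint.submodule ℝ A)

/-- Coordinates of the second kind on `A` near `1`, defined by a splitting `e` of the skew-adjoint
part of `A`; the unitary elements are given by the vanishing of the last coordinate. -/
noncomputable def expMulExp (p : (F × F') × selfAdjoint.submodule ℝ A) : A :=
  exp (e (p.1.1, 0) : A) * exp (e (0, p.1.2) : A) * (1 + p.2)

@[simp]
theorem expMulExp_zero : expMulExp e 0 = 1 := by
  simp [expMulExp, ← Prod.zero_eq_mk]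

theorem expMulExp_mem_unitary_iff [CompleteSpace A] [ContinuousStar A]
    {p : (F × F') × selfAdjoint.submodule ℝ A} (hp : IsUnit (2 + (p.2 : A))) :
    expMulExp e p ∈ unitary A ↔ p.2 = 0 := by
  have hmul : exp (e (p.1.1, 0) : A) * exp (e (0, p.1.2) : A) ∈ unitary A :=
    mul_mem (exp_mem_unitary _) (exp_mem_unitary _)
  have hcancel : expMulExp e p ∈ unitary A ↔ 1 + (p.2 : A) ∈ unitary A := by
    refine ⟨fun h => ?_, mul_mem hmul⟩
    simpa only [expMulExp, ← mul_assoc, (Unitary.mem_iff.1 hmul).1, one_mul] using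
      mul_mem (Unitary.star_mem hmul) h
  rw [hcancel, one_add_mem_unitary_iff p.2.2 hp, ZeroMemClass.coe_eq_zero]

variable [FiniteDimensional ℝ A]

/-- The derivative of `expMulExp e` at the origin. -/
noncomputable def expMulExpDeriv : ((F × F') × selfAdjoint.submodule ℝ A) ≃L[ℝ] A :=
  (e.prodCongr (.refl ℝ _)).trans
    (Submodule.prodEquivOfIsCompl _ _ isCompl_skewAdjoint_selfAdjoint).toContinuousLinearEquiv

theorem hasFDerivAt_expMulExp :
    HasFDerivAt (expMulExp e) (expMulExpDeriv e : (F × F') × selfAdjoint.submodule ℝ A →L[ℝ] A)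
      0 := by
  have := FiniteDimensional.complete ℝ A
  let 𝔲 := skewAdjoint.submodule ℝ A
  let 𝔭 := selfAdjoint.submodule ℝ A
  have h₁ := hasFDerivAt_exp_comp (𝔲.subtypeL ∘L (e : F × F' →L[ℝ] 𝔲) ∘L .inl ℝ F F' ∘L
    .fst ℝ F F' ∘L .fst ℝ (F × F') 𝔭)
  have h₂ := hasFDerivAt_exp_comp (𝔲.subtypeL ∘L (e : F × F' →L[ℝ] 𝔲) ∘L .inr ℝ F F' ∘L
    .snd ℝ F F' ∘L .fst ℝ (F × F') 𝔭)
  have h₃ := ((𝔭.subtypeL ∘L .snd ℝ (F × F') 𝔭).hasFDerivAt (x := 0)).const_add (1 : A)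
  refine ((h₁.mul' h₂).mul' h₃).congr_fderiv (ContinuousLinearMap.ext fun p => ?_)
  have hsplit : e p.1 = e (p.1.1, 0) + e (0, p.1.2) := by simp [← map_add]
  simp [expMulExpDeriv, hsplit, 𝔲, 𝔭, ← Prod.zero_eq_mk, add_comm]

theorem contDiff_expMulExp : ContDiff ℝ ∞ (expMulExp e) := by
  have := FiniteDimensional.complete ℝ A
  have hexp {X : F × F' → F × F'} (hX : ContDiff ℝ ∞ X) :
      ContDiff ℝ ∞ fun p : (F × F') × selfAdjoint.submodule ℝ A => exp (e (X p.1) : A) :=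
    contDiff_exp.comp ((Submodule.subtypeL _).contDiff.comp
      (e.contDiff.comp (hX.comp contDiff_fst)))
  exact ((hexp (contDiff_fst.prodMk contDiff_const)).mul
    (hexp (contDiff_const.prodMk contDiff_snd))).mul
    (contDiff_const.add
      ((selfAdjoint.submodule ℝ A).subtypeL.contDiff.comp contDiff_snd))

theorem exists_slicePatch_unitary [ContinuousStar A] {U : Set (F × F')} (hU : U ∈ 𝓝 0) :
    ∃ P : SlicePatch (unitary A : Set A) (F × F') (selfAdjoint.submodule ℝ A), 0 ∈ P.source ∧
      (∀ p ∈ P.source, p.1 ∈ U) ∧ ∀ p, P p = expMulExp e p := by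
  have := FiniteDimensional.complete ℝ A
  have := (expMulExpDeriv e).symm.toLinearEquiv.finiteDimensional
  have := FiniteDimensional.complete ℝ ((F × F') × selfAdjoint.submodule ℝ A)
  refine exists_slicePatch (contDiff_expMulExp e) (hasFDerivAt_expMulExp e) ?_
    (continuous_fst.continuousAt.preimage_mem_nhds hU)
  have hunit : IsUnit (2 : A) := by
    rw [← map_ofNat (algebraMap ℝ A) 2]
    exact (IsUnit.mk0 (2 : ℝ) two_ne_zero).map _
  have hopen : IsOpen {p : (F × F') × selfAdjoint.submodule ℝ A | IsUnit (2 + (p.2 : A))} :=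
    Units.isOpen.preimage (by fun_prop)
  filter_upwards [hopen.mem_nhds (by simpa using hunit)] with p hp
  exact expMulExp_mem_unitary_iff e hp

theorem eventually_exists_eq_exp_mul_exp [ContinuousStar A] {U : Set F} (hU : U ∈ 𝓝 0) :
    ∀ᶠ u : unitary A in 𝓝 1, ∃ x ∈ U, ∃ y, (u : A) = exp (e (x, 0) : A) * exp (e (0, y) : A) := by
  obtain ⟨P, h0, hPU, hP⟩ := exists_slicePatch_unitary e
    (continuous_fst.continuousAt.preimage_mem_nhds hU : Prod.fst ⁻¹' U ∈ 𝓝 (0 : F × F'))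
  have h1 : (1 : A) ∈ P.target := by
    simpa only [hP, expMulExp_zero] using P.map_source h0
  have hnhds : Subtype.val ⁻¹' P.target ∈ 𝓝 (1 : unitary A) :=
    continuous_subtype_val.continuousAt.preimage_mem_nhds (P.open_target.mem_nhds h1)
  filter_upwards [hnhds] with u hu
  refine ⟨_, hPU _ (P.map_target hu), (P.symm u).1.2, ?_⟩
  have h2 := hP (P.symm u)
  rw [P.right_inv hu, expMulExp, P.symm_snd_eq_zero hu u.2] at h2
  simpa using h2

end GroupPatch

end ExponentialCoordinates

section OrbitSlices

open Set Topology NormedSpace MulAction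

section OrbitMap

variable {G X : Type*} [Group G] [TopologicalSpace G] [CompactSpace G] [TopologicalSpace X]
  [T2Space X] [MulAction G X] {x : X}

theorem isEmbedding_ofQuotientStabilizer (hx : Continuous fun g : G => g • x) :
    IsEmbedding (ofQuotientStabilizer G x) :=
  (Continuous.isClosedEmbedding (hx.quotient_lift _)
    (injective_ofQuotientStabilizer G x)).isEmbedding

theorem image_smul_mem_nhdsWithin_orbit [ContinuousMul G] (hx : Continuous fun g : G => g • x)
    {W : Set G} (hW : W ∈ 𝓝 1) : (· • x) '' W ∈ 𝓝[MulAction.orbit G x] x := by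
  have hmk : ((↑) : G → G ⧸ stabilizer G x) '' W ∈ 𝓝 ((1 : G) : G ⧸ stabilizer G x) :=
    QuotientGroup.isOpenMap_coe.image_mem_nhds hW
  rw [(isEmbedding_ofQuotientStabilizer hx).nhds_eq_comap, Filter.mem_comap,
    ofQuotientStabilizer_mk, one_smul] at hmk
  obtain ⟨V, hV, hVW⟩ := hmk
  filter_upwards [mem_nhdsWithin_of_mem_nhds hV, self_mem_nhdsWithin]
  rintro _ hg ⟨g, rfl⟩
  obtain ⟨w, hw, hwg⟩ := hVW (show (g : G ⧸ stabilizer G x) ∈ _ from hg)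
  exact ⟨w, hw, congrArg (ofQuotientStabilizer G x) hwg⟩

end OrbitMap

section Slice

variable {A B : Type*} [NormedRing A] [NormedAlgebra ℝ A] [StarRing A] [StarModule ℝ A]
  [NormedRing B] [NormedAlgebra ℝ B] {F F' : Type*} [NormedAddCommGroup F] [NormedSpace ℝ F]
  [NormedAddCommGroup F'] [NormedSpace ℝ F']
  (α : A →ₐ[ℝ] B) (K : B) (e : (F × F') ≃L[ℝ] skewAdjoint.submodule ℝ A)

/-- The action on `K` of the Lie algebra of the unitary group of `A`, which is the derivative of
the conjugation action through `α`. -/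
noncomputable def infinitesimalAction : skewAdjoint.submodule ℝ A →ₗ[ℝ] B :=
  (LinearMap.mulRight ℝ K - LinearMap.mulLeft ℝ K) ∘ₗ α.toLinearMap ∘ₗ
    (skewAdjoint.submodule ℝ A).subtype

theorem infinitesimalAction_apply (X : skewAdjoint.submodule ℝ A) :
    infinitesimalAction α K X = α X * K - K * α X := rfl

/-- The parametrization, by the first summand of `e`, of the tangent space at `K` of the orbit
of `K`. -/
noncomputable def orbitTangent : F →ₗ[ℝ] B :=
  infinitesimalAction α K ∘ₗ (e : (F × F') →ₗ[ℝ] skewAdjoint.submodule ℝ A) ∘ₗ .inl ℝ F F'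

theorem orbitTangent_apply (x : F) :
    orbitTangent α K e x = infinitesimalAction α K (e (x, 0)) := rfl

/-- Coordinates of `B` near `K`: the orbit of `K` is the image of `F × {0}`. -/
noncomputable def orbitSlice (N : Submodule ℝ B) (p : F × N) : B :=
  α (exp (e (p.1, 0) : A)) * K * α (exp (-(e (p.1, 0) : A))) + p.2

@[simp]
theorem orbitSlice_zero (N : Submodule ℝ B) : orbitSlice α K e N 0 = K := by
  simp [orbitSlice, ← Prod.zero_eq_mk]

theorem contDiff_orbitSlice [FiniteDimensional ℝ A] (N : Submodule ℝ B) :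
    ContDiff ℝ ∞ (orbitSlice α K e N) := by
  have := FiniteDimensional.complete ℝ A
  have hexp (X : F →L[ℝ] A) : ContDiff ℝ ∞ fun p : F × N => α (exp (X p.1)) :=
    α.toLinearMap.toContinuousLinearMap.contDiff.comp
      (contDiff_exp.comp (X.contDiff.comp contDiff_fst))
  let X : F →L[ℝ] A := (skewAdjoint.submodule ℝ A).subtypeL ∘L
    (e : F × F' →L[ℝ] skewAdjoint.submodule ℝ A) ∘L .inl ℝ F F'
  exact (((hexp X).mul contDiff_const).mul (hexp (-X))).add
    (N.subtypeL.contDiff.comp contDiff_snd)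

variable {α K e}

theorem commute_exp_of_infinitesimalAction_eq_zero [FiniteDimensional ℝ A]
    {X : skewAdjoint.submodule ℝ A} (hX : infinitesimalAction α K X = 0) :
    Commute (α (exp (X : A))) K := by
  let _ : NormedAlgebra ℚ A := NormedAlgebra.restrictScalars ℚ ℝ A
  let _ : NormedAlgebra ℚ B := NormedAlgebra.restrictScalars ℚ ℝ B
  have := FiniteDimensional.complete ℝ A
  have hα : Continuous α := α.toLinearMap.continuous_of_finiteDimensional
  rw [map_exp α hα]
  exact Commute.exp_left (sub_eq_zero.1 hX)

variable {G : Type*} [Group G] [TopologicalSpace G]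
  {ι : G ≃ₜ* unitary A} {N : Submodule ℝ B} [MulAction G B]
  (hsmul : ∀ (g : G) (b : B), g • b = α (ι g) * b * α (star (ι g : A)))

section Conjugation

include hsmul

omit [StarModule ℝ A] in
theorem continuous_smul_of_conjugation [FiniteDimensional ℝ A] [ContinuousStar A] :
    Continuous fun g : G => g • K := by
  have hα : Continuous α := α.toLinearMap.continuous_of_finiteDimensional
  have : Continuous fun g : G => (ι g : A) := continuous_subtype_val.comp ι.continuous
  simp only [hsmul]
  fun_prop

theorem smul_eq_orbitSlice [FiniteDimensional ℝ A] [ContinuousStar A]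
    (hF' : ∀ y, infinitesimalAction α K (e (0, y)) = 0) {x : F} {y : F'} {g : G}
    (hg : (ι g : A) = exp (e (x, 0) : A) * exp (e (0, y) : A)) :
    g • K = orbitSlice α K e N (x, 0) := by
  let _ : NormedAlgebra ℚ A := NormedAlgebra.restrictScalars ℚ ℝ A
  have hfix : α (exp (e (0, y) : A)) * K * α (star (exp (e (0, y) : A))) = K := by
    rw [(commute_exp_of_infinitesimalAction_eq_zero (hF' y)).eq, mul_assoc, ← map_mul,
      (Unitary.mem_iff.1 (exp_mem_unitary (e (0, y)))).2, map_one, mul_one]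
  have hstar : star (exp (e (x, 0) : A)) = exp (-(e (x, 0) : A)) := by
    rw [star_exp, skewAdjoint.mem_iff.1 (e (x, 0)).2]
  calc g • K = α (exp (e (x, 0) : A)) * (α (exp (e (0, y) : A)) * K *
        α (star (exp (e (0, y) : A)))) * α (star (exp (e (x, 0) : A))) := by
        rw [hsmul, hg, star_mul, map_mul, map_mul]
        simp only [mul_assoc]
    _ = orbitSlice α K e N (x, 0) := by
        rw [hfix, hstar, orbitSlice, ZeroMemClass.coe_zero, add_zero]

theorem exists_smul_eq_orbitSlice [FiniteDimensional ℝ A] [ContinuousStar A]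
    (hF' : ∀ y, infinitesimalAction α K (e (0, y)) = 0) (x : F) :
    ∃ g : G, g • K = orbitSlice α K e N (x, 0) := by
  have := FiniteDimensional.complete ℝ A
  refine ⟨ι.symm ⟨_, exp_mem_unitary (e (x, 0))⟩, smul_eq_orbitSlice hsmul hF' (y := 0) ?_⟩
  simp [← Prod.zero_eq_mk]

end Conjugation

variable [FiniteDimensional ℝ B]

/-- The derivative of `orbitSlice α K e N` at the origin. -/
noncomputable def orbitSliceDeriv (hinj : Function.Injective (orbitTangent α K e))
    (hN : IsCompl (LinearMap.range (orbitTangent α K e)) N) [FiniteDimensional ℝ F] :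
    (F × N) ≃L[ℝ] B :=
  (((LinearEquiv.ofInjective _ hinj).prodCongr (.refl ℝ N)).trans
    (Submodule.prodEquivOfIsCompl _ _ hN)).toContinuousLinearEquiv

theorem orbitSliceDeriv_apply (hinj : Function.Injective (orbitTangent α K e))
    (hN : IsCompl (LinearMap.range (orbitTangent α K e)) N) [FiniteDimensional ℝ F] (p : F × N) :
    orbitSliceDeriv hinj hN p = orbitTangent α K e p.1 + p.2 := rfl

theorem hasFDerivAt_orbitSlice [FiniteDimensional ℝ A] [FiniteDimensional ℝ F]
    (hinj : Function.Injective (orbitTangent α K e))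
    (hN : IsCompl (LinearMap.range (orbitTangent α K e)) N) :
    HasFDerivAt (orbitSlice α K e N) (orbitSliceDeriv hinj hN : F × N →L[ℝ] B) 0 := by
  have := FiniteDimensional.complete ℝ A
  let L : A →L[ℝ] B := α.toLinearMap.toContinuousLinearMap
  let X : F × N →L[ℝ] A := (skewAdjoint.submodule ℝ A).subtypeL ∘L
    (e : F × F' →L[ℝ] skewAdjoint.submodule ℝ A) ∘L .inl ℝ F F' ∘L .fst ℝ F N
  have h₁ := (L.hasFDerivAt.comp 0 (hasFDerivAt_exp_comp X)).mul_const' K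
  have h₂ := L.hasFDerivAt.comp 0 (hasFDerivAt_exp_comp (-X))
  refine ((h₁.mul' h₂).add (N.subtypeL ∘L .snd ℝ F N).hasFDerivAt).congr_fderiv
    (ContinuousLinearMap.ext fun p => ?_)
  simp [L, X, orbitSliceDeriv_apply, orbitTangent_apply, infinitesimalAction_apply,
    ← Prod.zero_eq_mk, neg_add_eq_sub]

section OrbitPatch

variable [FiniteDimensional ℝ A] [FiniteDimensional ℝ F] [ContinuousStar A] [CompactSpace G]
  [IsTopologicalGroup G] (hF' : ∀ y, infinitesimalAction α K (e (0, y)) = 0)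
  (hinj : Function.Injective (orbitTangent α K e))
  (hN : IsCompl (LinearMap.range (orbitTangent α K e)) N)
include hsmul hF' hinj hN

theorem eventually_orbitSlice_mem_orbit_iff :
    ∀ᶠ p in 𝓝 0, orbitSlice α K e N p ∈ MulAction.orbit G K ↔ p.2 = 0 := by
  have := FiniteDimensional.complete ℝ (F × N)
  obtain ⟨P, h0, -, hP, -⟩ := exists_openPartialHomeomorph (contDiff_orbitSlice α K e N)
    (hasFDerivAt_orbitSlice hinj hN) Filter.univ_mem
  have hP0 : P 0 = K := by rw [hP, orbitSlice_zero]
  have hU : (fun x : F => (x, (0 : N))) ⁻¹' P.source ∈ 𝓝 0 :=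
    (Continuous.prodMk_left (0 : N)).continuousAt.preimage_mem_nhds (P.open_source.mem_nhds h0)
  have hW := (ι.continuous.tendsto' 1 1 (map_one ι)).eventually
    (eventually_exists_eq_exp_mul_exp e hU)
  have hV := image_smul_mem_nhdsWithin_orbit (continuous_smul_of_conjugation hsmul (K := K)) hW
  have hcont : Filter.Tendsto P (𝓝 0) (𝓝 K) := hP0 ▸ P.continuousAt h0
  have hnear := hcont.eventually (eventually_nhdsWithin_iff.1 hV)
  filter_upwards [P.open_source.mem_nhds h0, hnear] with ⟨x, w⟩ hp horbit
  constructor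
  · intro hmem
    obtain ⟨g, ⟨x', hx', y, hg⟩, hgK⟩ := horbit (hP (x, w) ▸ hmem)
    have heq : P (x', 0) = P (x, w) := by
      rw [← hgK, hP]
      exact (smul_eq_orbitSlice hsmul hF' hg).symm
    exact congrArg Prod.snd (P.injOn hx' hp heq).symm
  · rintro (rfl : w = 0)
    exact exists_smul_eq_orbitSlice hsmul hF' x

theorem exists_compatible_slicePatches :
    ∃ (P : SlicePatch (unitary A : Set A) (F × F') (selfAdjoint.submodule ℝ A))
      (Q : SlicePatch (MulAction.orbit G K) F N), 0 ∈ P.source ∧ 0 ∈ Q.source ∧ P 0 = 1 ∧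
      Q 0 = K ∧ ∀ z, (z, 0) ∈ P.source → (z.1, 0) ∈ Q.source ∧
        ∀ g : G, (ι g : A) = P (z, 0) → g • K = Q (z.1, 0) := by
  have := FiniteDimensional.complete ℝ (F × N)
  obtain ⟨Q, hQ0, -, hQ⟩ := exists_slicePatch (contDiff_orbitSlice α K e N)
    (hasFDerivAt_orbitSlice hinj hN) (eventually_orbitSlice_mem_orbit_iff hsmul hF' hinj hN)
    Filter.univ_mem
  have hU : (fun z : F × F' => (z.1, (0 : N))) ⁻¹' Q.source ∈ 𝓝 0 :=
    Continuous.continuousAt (by fun_prop) |>.preimage_mem_nhds (Q.open_source.mem_nhds hQ0)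
  obtain ⟨P, hP0, hPU, hP⟩ := exists_slicePatch_unitary e hU
  refine ⟨P, Q, hP0, hQ0, ?_, ?_, fun z hz => ⟨hPU _ hz, fun g hg => ?_⟩⟩
  · rw [hP, expMulExp_zero]
  · rw [hQ, orbitSlice_zero]
  · rw [hQ]
    refine smul_eq_orbitSlice hsmul hF' (y := z.2) ?_
    rw [hg, hP, expMulExp, ZeroMemClass.coe_zero, add_zero, mul_one]

end OrbitPatch

end Slice

end OrbitSlices

section OrbitSmoothStructure

open Set Topology Module MulAction

theorem exists_splitting_of_ker {V W : Type*} [NormedAddCommGroup V] [NormedSpace ℝ V]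
    [FiniteDimensional ℝ V] [AddCommGroup W] [Module ℝ W] (f : V →ₗ[ℝ] W) :
    ∃ (d d' : ℕ) (e : (EuclideanSpace ℝ (Fin d) × EuclideanSpace ℝ (Fin d')) ≃L[ℝ] V),
      (∀ y, f (e (0, y)) = 0) ∧ Function.Injective fun x => f (e (x, 0)) := by
  obtain ⟨𝔪, h𝔪⟩ := f.ker.exists_isCompl
  let e₁ : EuclideanSpace ℝ (Fin (finrank ℝ 𝔪)) ≃ₗ[ℝ] 𝔪 := toEuclidean.symm.toLinearEquiv
  let e₂ : EuclideanSpace ℝ (Fin (finrank ℝ f.ker)) ≃ₗ[ℝ] f.ker :=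
    toEuclidean.symm.toLinearEquiv
  let e := ((e₁.prodCongr e₂).trans
    (Submodule.prodEquivOfIsCompl 𝔪 f.ker h𝔪.symm)).toContinuousLinearEquiv
  have he (p) : e p = (e₁ p.1 : V) + e₂ p.2 := rfl
  refine ⟨_, _, e, fun y => ?_, fun x x' hx => ?_⟩
  · simp [he]
  · have hker : ((e₁ x - e₁ x' : 𝔪) : V) ∈ f.ker := by
      simpa [he, sub_eq_zero] using hx
    have hzero := Submodule.disjoint_def.1 h𝔪.disjoint _ hker (e₁ x - e₁ x').2
    exact e₁.injective (sub_eq_zero.1 (Subtype.ext hzero))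

variable {A B E G : Type*} [NormedRing A] [NormedAlgebra ℝ A] [StarRing A] [StarModule ℝ A]
  [CStarRing A] [FiniteDimensional ℝ A] [NormedRing B] [NormedAlgebra ℝ B]
  [FiniteDimensional ℝ B] [NormedAddCommGroup E] [NormedSpace ℝ E] [Group G] [TopologicalSpace G]
  [IsTopologicalGroup G] [DistribMulAction G B] [SMulCommClass G ℝ B] [ContinuousConstSMul G B]
  {α : A →ₐ[ℝ] B} {ι : G ≃ₜ* unitary A}

theorem smul_mem_orbit_iff {G X : Type*} [Group G] [MulAction G X] {x y : X} (g : G) :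
    g • y ∈ MulAction.orbit G x ↔ y ∈ MulAction.orbit G x := by
  rw [← orbit_eq_iff, orbit_smul, orbit_eq_iff]

omit [StarModule ℝ A] [CStarRing A] [FiniteDimensional ℝ A] [IsTopologicalGroup G] in
theorem apply_smul_mem_range_iff {T : A ≃L[ℝ] E} {i : G → E} (hi : ∀ g, i g = T (ι g)) (g : G)
    (y : A) : T (ι g • y) ∈ range i ↔ y ∈ unitary A := by
  constructor
  · rintro ⟨g', hg'⟩
    have hy : y = ι (g⁻¹ * g') := by
      rw [hi, T.injective.eq_iff] at hg'
      rw [map_mul, map_inv, Submonoid.coe_mul, hg']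
      exact (inv_smul_smul (ι g) y).symm
    exact hy ▸ (ι (g⁻¹ * g')).2
  · intro hy
    exact ⟨g * ι.symm ⟨y, hy⟩, by simp [hi, Submonoid.smul_def]⟩

/-- The slice patches at `1` and at `K` are carried to all other points by the action of `G`, with
which the orbit map commutes. The identification `T` allows `G` to be embedded into a space `E`
which carries another norm than `A`. -/
theorem exists_compatible_sliceAtlases (T : A ≃L[ℝ] E) {i : G → E} (hi : ∀ g, i g = T (ι g))
    (hsmul : ∀ (g : G) (b : B), g • b = α (ι g) * b * α (star (ι g : A))) (K : B) :
    ∃ (c d d' : ℕ) (N : Submodule ℝ B) (q : EuclideanSpace ℝ (Fin c) ≃L[ℝ]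
        EuclideanSpace ℝ (Fin d) × EuclideanSpace ℝ (Fin d'))
      (s : SliceAtlas (range i) G (EuclideanSpace ℝ (Fin c)) (selfAdjoint.submodule ℝ A))
      (t : SliceAtlas (MulAction.orbit G K) G (EuclideanSpace ℝ (Fin d)) N),
      ∀ a z, (z, 0) ∈ (s.patch a).source → ((q z).1, 0) ∈ (t.patch a).source ∧
        ∀ g, i g = s.patch a (z, 0) → g • K = t.patch a ((q z).1, 0) := by
  have : CompactSpace (unitary A) := isCompact_iff_compactSpace.1 isCompact_unitary
  have : CompactSpace G := ι.symm.toHomeomorph.compactSpace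
  obtain ⟨d, d', e, hF', hinj⟩ := exists_splitting_of_ker (infinitesimalAction α K)
  obtain ⟨N, hN⟩ := (LinearMap.range (orbitTangent α K e)).exists_isCompl
  obtain ⟨P, Q, hP0, hQ0, hP1, hQK, hPQ⟩ := exists_compatible_slicePatches hsmul hF' hinj hN
  let q : EuclideanSpace ℝ (Fin _) ≃L[ℝ] EuclideanSpace ℝ (Fin d) × EuclideanSpace ℝ (Fin d') :=
    toEuclidean.symm
  let s : SliceAtlas (range i) G _ _ := .ofTranslates P hP0 q
    (fun g => (ContinuousLinearEquiv.smulLeft (ι g)).trans T) (apply_smul_mem_range_iff hi)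
    (fun _ ⟨g, hg⟩ => ⟨g, by simp [← hg, hi, hP1, Submonoid.smul_def]⟩)
    ((q.prodCongr (.refl ℝ _)).trans ((expMulExpDeriv e).trans T))
  let t : SliceAtlas (MulAction.orbit G K) G _ _ := .ofTranslates Q hQ0 (.refl ℝ _)
    ContinuousLinearEquiv.smulLeft (fun g _ => smul_mem_orbit_iff g)
    (fun _ ⟨g, hg⟩ => ⟨g, by rw [hQK]; exact hg⟩) (orbitSliceDeriv hinj hN)
  refine ⟨_, d, d', N, q, s, t, fun a z hz => ⟨(hPQ _ hz).1, fun g hg => ?_⟩⟩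
  have hP : (ι (a⁻¹ * g) : A) = P (q z, 0) := by
    have hg' : T (ι g) = T (ι a • P (q z, 0)) := (hi g).symm.trans hg
    rw [map_mul, map_inv, Submonoid.coe_mul, T.injective hg']
    exact inv_smul_smul (ι a) (P (q z, 0))
  calc g • K = a • (a⁻¹ * g) • K := by rw [smul_smul, mul_inv_cancel_left]
    _ = t.patch a ((q z).1, 0) := congrArg (a • ·) ((hPQ _ hz).2 _ hP)

theorem exists_smoothStructure_orbit (T : A ≃L[ℝ] E) {i : G → E} (hi : ∀ g, i g = T (ι g))
    (hsmul : ∀ (g : G) (b : B), g • b = α (ι g) * b * α (star (ι g : A))) (K : B) :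
    ∃ (c d : ℕ) (_ : ChartedSpace (EuclideanSpace ℝ (Fin c)) G)
      (_ : ChartedSpace (EuclideanSpace ℝ (Fin d)) (G ⧸ stabilizer G K))
      (_ : ChartedSpace (EuclideanSpace ℝ (Fin d)) (MulAction.orbit G K)),
      IsEmbeddedSubmanifold c i ∧ IsQuotientManifold c (stabilizer G K) d ∧
      IsEmbeddedSubmanifold d (Subtype.val : MulAction.orbit G K → B) ∧
      ∃ Φ : Diffeomorph (𝓡 d) (𝓡 d) (G ⧸ stabilizer G K) (MulAction.orbit G K) ∞,
        ∀ g : G, (Φ g : B) = g • K := by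
  have : CompactSpace (unitary A) := isCompact_iff_compactSpace.1 isCompact_unitary
  have : CompactSpace G := ι.symm.toHomeomorph.compactSpace
  obtain ⟨c, d, _, _, q, s, t, hst⟩ := exists_compatible_sliceAtlases T hi hsmul K
  have hi_emb : IsEmbedding i := by
    rw [show i = T ∘ Subtype.val ∘ ι from funext hi]
    exact T.toHomeomorph.isEmbedding.comp (.comp .subtypeVal ι.toHomeomorph.isEmbedding)
  have hj := isEmbedding_ofQuotientStabilizer (continuous_smul_of_conjugation hsmul (K := K))
  have hj_range : range (ofQuotientStabilizer G K) = MulAction.orbit G K := by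
    rw [← QuotientGroup.mk_surjective.range_comp]
    rfl
  have hv := IsEmbedding.subtypeVal (p := (· ∈ MulAction.orbit G K))
  have : Nonempty (MulAction.orbit G K) := (MulAction.nonempty_orbit K).to_subtype
  obtain ⟨Φ, hΦ⟩ := t.exists_diffeomorph hj hj_range hv Subtype.range_val
  exact ⟨c, d, s.chartedSpace hi_emb rfl, t.chartedSpace hj hj_range,
    t.chartedSpace hv Subtype.range_val, ⟨s.isManifold _ _, s.isSmoothEmbedding _ _⟩,
    ⟨t.isManifold _ _, s.isSubmersion _ _ t hj hj_range q (fun a z hz => (hst a z hz).1)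
      fun a z hz => (hst a z hz).2⟩,
    ⟨t.isManifold _ _, t.isSmoothEmbedding _ _⟩, Φ, fun g => hΦ g⟩

end OrbitSmoothStructure

section Frames

open Module Set

variable {V : Type*} [NormedAddCommGroup V] [InnerProductSpace ℝ V]

section ComplexStructures

/-- `J` restricts to an orthogonal complex structure of the subspace `W`. Orthogonality is expressed
as skew symmetry, which is equivalent to it in the presence of `J² = -1`. -/
structure IsComplexStructureOn (J : V →L[ℝ] V) (W : Submodule ℝ V) : Prop where
  apply_mem : ∀ x ∈ W, J x ∈ W
  apply_apply : ∀ x ∈ W, J (J x) = -x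
  inner_apply_left : ∀ x ∈ W, ∀ y ∈ W, ⟪J x, y⟫_ℝ = -⟪x, J y⟫_ℝ

variable {J I : V →L[ℝ] V} {W : Submodule ℝ V}

namespace IsComplexStructureOn

theorem inner_apply_right (hJ : IsComplexStructureOn J W) {x y : V} (hx : x ∈ W) (hy : y ∈ W) :
    ⟪x, J y⟫_ℝ = -⟪J x, y⟫_ℝ := by
  rw [hJ.inner_apply_left x hx y hy, neg_neg]

theorem inner_apply_apply (hJ : IsComplexStructureOn J W) {x y : V} (hx : x ∈ W) (hy : y ∈ W) :
    ⟪J x, J y⟫_ℝ = ⟪x, y⟫_ℝ := by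
  rw [hJ.inner_apply_right (hJ.apply_mem x hx) hy, hJ.apply_apply x hx, inner_neg_left, neg_neg]

theorem inner_self_apply (hJ : IsComplexStructureOn J W) {x : V} (hx : x ∈ W) :
    ⟪x, J x⟫_ℝ = 0 := by
  linarith [hJ.inner_apply_right hx hx, real_inner_comm x (J x)]

end IsComplexStructureOn

/-- The operators `1`, `J`, `I`, `JI`, which span the quaternions if `J` and `I` are anticommuting
complex structures. -/
def quaternionUnits (J I : V →L[ℝ] V) : Fin 4 → V →L[ℝ] V := ![1, J, I, J * I]

theorem quaternionUnits_apply_mem (hJ : IsComplexStructureOn J W) (hI : IsComplexStructureOn I W)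
    (i : Fin 4) {x : V} (hx : x ∈ W) : quaternionUnits J I i x ∈ W := by
  fin_cases i
  exacts [hx, hJ.apply_mem x hx, hI.apply_mem x hx, hJ.apply_mem _ (hI.apply_mem x hx)]

theorem inner_quaternionUnits_apply_self (hJ : IsComplexStructureOn J W)
    (hI : IsComplexStructureOn I W) (hIJ : ∀ x ∈ W, I (J x) = -J (I x)) {x : V} (hx : x ∈ W)
    (i j : Fin 4) :
    ⟪quaternionUnits J I i x, quaternionUnits J I j x⟫_ℝ = if i = j then ⟪x, x⟫_ℝ else 0 := by
  have hJx := hJ.apply_mem x hx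
  have hIx := hI.apply_mem x hx
  have h01 : ⟪x, J x⟫_ℝ = 0 := hJ.inner_self_apply hx
  have h02 : ⟪x, I x⟫_ℝ = 0 := hI.inner_self_apply hx
  have h12 : ⟪J x, I x⟫_ℝ = 0 := by
    have h1 : ⟪J x, I x⟫_ℝ = ⟪J (I x), x⟫_ℝ := by
      rw [hI.inner_apply_right hJx hx, hIJ x hx, inner_neg_left, neg_neg]
    linarith [hJ.inner_apply_left _ hIx x hx, real_inner_comm (J x) (I x)]
  have h03 : ⟪x, J (I x)⟫_ℝ = 0 := by rw [hJ.inner_apply_right hx hIx, h12, neg_zero]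
  have h13 : ⟪J x, J (I x)⟫_ℝ = 0 := by rw [hJ.inner_apply_apply hx hIx, h02]
  have h23 : ⟪I x, J (I x)⟫_ℝ = 0 := hJ.inner_self_apply hIx
  have h33 : ⟪J (I x), J (I x)⟫_ℝ = ⟪x, x⟫_ℝ := by
    rw [hJ.inner_apply_apply hIx hIx, hI.inner_apply_apply hx hx]
  fin_cases i <;> fin_cases j <;>
    simp [quaternionUnits, h01, h02, h03, h12, h13, h23, h33, hJ.inner_apply_apply hx hx,
      hI.inner_apply_apply hx hx, real_inner_comm x, real_inner_comm (J x) (I x),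
      real_inner_comm (J x) (J (I x)), real_inner_comm (I x) (J (I x)),
      -inner_self_eq_norm_sq_to_K]

theorem forall_inner_quaternionUnits_left_apply_eq_zero (hJ : IsComplexStructureOn J W)
    (hI : IsComplexStructureOn I W) {x y : V} (hx : x ∈ W) (hy : y ∈ W)
    (h : ∀ i, ⟪quaternionUnits J I i x, y⟫_ℝ = 0) (i : Fin 4) :
    ⟪quaternionUnits J I i x, J y⟫_ℝ = 0 := by
  have hIx := hI.apply_mem x hx
  fin_cases i
  · exact (hJ.inner_apply_right hx hy).trans (neg_eq_zero.2 (h 1))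
  · exact (hJ.inner_apply_apply hx hy).trans (h 0)
  · exact (hJ.inner_apply_right hIx hy).trans (neg_eq_zero.2 (h 3))
  · exact (hJ.inner_apply_apply hIx hy).trans (h 2)

theorem forall_inner_quaternionUnits_right_apply_eq_zero (hJ : IsComplexStructureOn J W)
    (hI : IsComplexStructureOn I W) (hIJ : ∀ x ∈ W, I (J x) = -J (I x)) {x y : V} (hx : x ∈ W)
    (hy : y ∈ W) (h : ∀ i, ⟪quaternionUnits J I i x, y⟫_ℝ = 0) (i : Fin 4) :
    ⟪quaternionUnits J I i x, I y⟫_ℝ = 0 := by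
  have hIx := hI.apply_mem x hx
  have h0 : ⟪x, y⟫_ℝ = 0 := h 0
  have h1 : ⟪J x, y⟫_ℝ = 0 := h 1
  have h2 : ⟪I x, y⟫_ℝ = 0 := h 2
  have h3 : ⟪J (I x), y⟫_ℝ = 0 := h 3
  fin_cases i
  · simpa [quaternionUnits, hI.inner_apply_right hx hy] using h2
  · simpa [quaternionUnits, hI.inner_apply_right (hJ.apply_mem x hx) hy, hIJ x hx] using h3
  · simpa [quaternionUnits, hI.inner_apply_apply hx hy] using h0
  · simpa [quaternionUnits, hI.inner_apply_right (hJ.apply_mem _ hIx) hy, hIJ _ hIx,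
      hI.apply_apply x hx] using h1

theorem inner_quaternionUnits_apply_eq_zero (hJ : IsComplexStructureOn J W)
    (hI : IsComplexStructureOn I W) (hIJ : ∀ x ∈ W, I (J x) = -J (I x)) {x y : V} (hx : x ∈ W)
    (hy : y ∈ W) (h : ∀ i, ⟪quaternionUnits J I i x, y⟫_ℝ = 0) (i j : Fin 4) :
    ⟪quaternionUnits J I i x, quaternionUnits J I j y⟫_ℝ = 0 := by
  have hIy := forall_inner_quaternionUnits_right_apply_eq_zero hJ hI hIJ hx hy h
  fin_cases j
  exacts [h i, forall_inner_quaternionUnits_left_apply_eq_zero hJ hI hx hy h i, hIy i,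
    forall_inner_quaternionUnits_left_apply_eq_zero hJ hI hx (hI.apply_mem y hy) hIy i]

end ComplexStructures

section UnitaryFrames

variable {J I : V →L[ℝ] V} {W : Submodule ℝ V}

theorem exists_norm_eq_one_mem_orthogonal [FiniteDimensional ℝ V] {X : Submodule ℝ V} (hXW : X ≤ W)
    (hX : finrank ℝ X < finrank ℝ W) : ∃ w ∈ W, ‖w‖ = 1 ∧ w ∈ Xᗮ := by
  have hfinrank := Submodule.finrank_add_inf_finrank_orthogonal hXW
  have hne : Xᗮ ⊓ W ≠ ⊥ := fun h => by
    rw [h, finrank_bot] at hfinrank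
    omega
  obtain ⟨w, hw, hw0⟩ := Submodule.exists_mem_ne_zero_of_ne_bot hne
  have hmem := Submodule.smul_mem _ (‖w‖⁻¹ : ℝ) hw
  exact ⟨_, hmem.2, norm_smul_inv_norm (𝕜 := ℝ) hw0, hmem.1⟩

theorem orthonormal_snoc_orbits {r k : ℕ} {T : Fin r → V →L[ℝ] V} {u : Fin k → V} {w : V}
    (hu : Orthonormal ℝ fun p : Fin k × Fin r => T p.2 (u p.1)) (hw : Orthonormal ℝ fun i => T i w)
    (huw : ∀ a i j, ⟪T i (u a), T j w⟫_ℝ = 0) :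
    Orthonormal ℝ fun p : Fin (k + 1) × Fin r => T p.2 (Fin.snoc (α := fun _ => V) u w p.1) := by
  rw [orthonormal_iff_ite] at hu hw ⊢
  rintro ⟨a, i⟩ ⟨b, j⟩
  induction a using Fin.lastCases with
  | last =>
    induction b using Fin.lastCases with
    | last => simpa using hw i j
    | cast b =>
      have : Fin.last k ≠ b.castSucc := (Fin.castSucc_lt_last b).ne'
      simp [this, real_inner_comm _ (T i w), huw]
  | cast a =>
    induction b using Fin.lastCases with
    | last =>
      have : a.castSucc ≠ Fin.last k := (Fin.castSucc_lt_last a).ne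
      simp [this, huw]
    | cast b => simpa using hu (a, i) (b, j)

theorem exists_orthonormal_orbits [FiniteDimensional ℝ V] {r : ℕ} (hr : 0 < r)
    {T : Fin r → V →L[ℝ] V} (hW : ∀ i, ∀ x ∈ W, T i x ∈ W)
    (hT : ∀ x ∈ W, ∀ i j, ⟪T i x, T j x⟫_ℝ = if i = j then ⟪x, x⟫_ℝ else 0)
    (hperp : ∀ x ∈ W, ∀ y ∈ W, (∀ i, ⟪T i x, y⟫_ℝ = 0) → ∀ i j, ⟪T i x, T j y⟫_ℝ = 0)
    (k : ℕ) (hk : r * k ≤ finrank ℝ W) :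
    ∃ u : Fin k → V, (∀ a, u a ∈ W) ∧ Orthonormal ℝ fun p : Fin k × Fin r => T p.2 (u p.1) := by
  induction k with
  | zero => exact ⟨Fin.elim0, fun a => a.elim0, ⟨fun p => p.1.elim0, fun p => p.1.elim0⟩⟩
  | succ k ih =>
    obtain ⟨u, huW, hu⟩ := ih (le_trans (Nat.mul_le_mul_left r k.le_succ) hk)
    let X := Submodule.span ℝ (range fun p : Fin k × Fin r => T p.2 (u p.1))
    have hXW : X ≤ W := by
      rw [Submodule.span_le]
      rintro _ ⟨p, rfl⟩
      exact hW _ _ (huW _)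
    have hX : finrank ℝ X < finrank ℝ W := by
      have hle := finrank_range_le_card (R := ℝ) fun p : Fin k × Fin r => T p.2 (u p.1)
      rw [Fintype.card_prod, Fintype.card_fin, Fintype.card_fin] at hle
      have hX' : finrank ℝ X ≤ k * r := hle
      nlinarith
    obtain ⟨w, hwW, hw, hwX⟩ := exists_norm_eq_one_mem_orthogonal hXW hX
    refine ⟨Fin.snoc u w, Fin.lastCases (by simpa using hwW) (by simpa using huW),
      orthonormal_snoc_orbits hu (orthonormal_iff_ite.2 fun i j => ?_) fun a =>
        hperp _ (huW a) w hwW fun i => hwX _ (Submodule.subset_span ⟨(a, i), rfl⟩)⟩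
    simp [hT w hwW, hw]

/-- A family of vectors which is unitary for the complex structure `J`. -/
def IsUnitaryFrame (J : V →L[ℝ] V) {ι : Type*} (u : ι → V) : Prop :=
  Orthonormal ℝ u ∧ ∀ a b, ⟪u a, J (u b)⟫_ℝ = 0

theorem exists_unitaryFrame [FiniteDimensional ℝ V] (hJ : IsComplexStructureOn J W) {m : ℕ}
    (hm : finrank ℝ W = 2 * m) : ∃ u : Fin m → V, (∀ a, u a ∈ W) ∧ IsUnitaryFrame J u := by
  obtain ⟨u, huW, hu⟩ := exists_orthonormal_orbits two_pos (T := ![1, J]) (W := W)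
    (by simpa [Fin.forall_fin_two] using hJ.apply_mem)
    (fun x hx => by
      simp [Fin.forall_fin_two, hJ.inner_self_apply hx, hJ.inner_apply_apply hx hx,
        real_inner_comm x, -inner_self_eq_norm_sq_to_K])
    (fun x hx y hy h => by
      have h0 : ⟪x, y⟫_ℝ = 0 := h 0
      have h1 : ⟪J x, y⟫_ℝ = 0 := h 1
      simp [Fin.forall_fin_two, h0, h1, hJ.inner_apply_right hx hy, hJ.inner_apply_apply hx hy])
    m hm.ge
  have hinner := orthonormal_iff_ite.1 hu
  refine ⟨u, huW, orthonormal_iff_ite.2 fun a b => ?_, fun a b => ?_⟩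
  · simpa using hinner (a, 0) (b, 0)
  · simpa using hinner (a, 0) (b, 1)

theorem exists_quaternionicFrame [FiniteDimensional ℝ V] (hJ : IsComplexStructureOn J W)
    (hI : IsComplexStructureOn I W) (hIJ : ∀ x ∈ W, I (J x) = -J (I x)) {k : ℕ}
    (hk : finrank ℝ W = 4 * k) :
    ∃ u : Fin k ⊕ Fin k → V, (∀ a, u a ∈ W) ∧ IsUnitaryFrame J u ∧
      (∀ x, I (u (.inl x)) = u (.inr x)) ∧ ∀ x, I (u (.inr x)) = -u (.inl x) := by
  obtain ⟨u, huW, hu⟩ := exists_orthonormal_orbits four_pos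
    (fun i _ hx => quaternionUnits_apply_mem hJ hI i hx)
    (fun _ hx => inner_quaternionUnits_apply_self hJ hI hIJ hx)
    (fun _ hx _ hy => inner_quaternionUnits_apply_eq_zero hJ hI hIJ hx hy) k hk.ge
  have hinner := orthonormal_iff_ite.1 hu
  refine ⟨Sum.elim u fun x => I (u x), ?_, ⟨orthonormal_iff_ite.2 ?_, ?_⟩, fun _ => rfl,
    fun x => hI.apply_apply _ (huW x)⟩
  · rintro (a | a)
    exacts [huW a, hI.apply_mem _ (huW a)]
  · rintro (a | a) (b | b)
    · simpa [quaternionUnits] using hinner (a, 0) (b, 0)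
    · simpa [quaternionUnits] using hinner (a, 0) (b, 2)
    · simpa [quaternionUnits] using hinner (a, 2) (b, 0)
    · simpa [quaternionUnits] using hinner (a, 2) (b, 2)
  · rintro (a | a) (b | b)
    · simpa [quaternionUnits] using hinner (a, 0) (b, 1)
    · simpa [quaternionUnits] using hinner (a, 0) (b, 3)
    · simpa [quaternionUnits] using hinner (a, 2) (b, 1)
    · simpa [quaternionUnits] using hinner (a, 2) (b, 3)

variable {ι κ : Type*}

theorem IsUnitaryFrame.comp {u : ι → V} (hu : IsUnitaryFrame J u) {f : κ → ι}
    (hf : Function.Injective f) : IsUnitaryFrame J (u ∘ f) :=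
  ⟨hu.1.comp f hf, fun _ _ => hu.2 _ _⟩

theorem IsUnitaryFrame.sumElim {u : ι → V} {v : κ → V} (hu : IsUnitaryFrame J u)
    (hv : IsUnitaryFrame J v) (huv : ∀ a b, ⟪u a, v b⟫_ℝ = 0)
    (huJv : ∀ a b, ⟪u a, J (v b)⟫_ℝ = 0) (hvJu : ∀ b a, ⟪v b, J (u a)⟫_ℝ = 0) :
    IsUnitaryFrame J (Sum.elim u v) := by
  classical
  refine ⟨orthonormal_iff_ite.2 ?_, ?_⟩
  · rintro (a | a) (b | b)
    · simpa using orthonormal_iff_ite.1 hu.1 a b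
    · simpa using huv a b
    · simpa using (real_inner_comm _ _).trans (huv b a)
    · simpa using orthonormal_iff_ite.1 hv.1 a b
  · rintro (a | a) (b | b)
    exacts [hu.2 a b, huJv a b, hvJu a b, hv.2 a b]

theorem IsUnitaryFrame.sigma {ι : κ → Type*} {u : ∀ i, ι i → V} (hu : ∀ i, IsUnitaryFrame J (u i))
    (hij : ∀ i j, i ≠ j → ∀ a b, ⟪u i a, u j b⟫_ℝ = 0)
    (hijJ : ∀ i j, i ≠ j → ∀ a b, ⟪u i a, J (u j b)⟫_ℝ = 0) :
    IsUnitaryFrame J fun p : Σ i, ι i => u p.1 p.2 := by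
  classical
  refine ⟨orthonormal_iff_ite.2 ?_, ?_⟩
  · rintro ⟨i, a⟩ ⟨j, b⟩
    obtain rfl | h := eq_or_ne i j
    · simpa using orthonormal_iff_ite.1 (hu i).1 a b
    · simpa [h] using hij i j h a b
  · rintro ⟨i, a⟩ ⟨j, b⟩
    obtain rfl | h := eq_or_ne i j
    exacts [(hu i).2 a b, hijJ i j h a b]

end UnitaryFrames

end Frames

section Eigenspaces

open Module

variable {V : Type*} [NormedAddCommGroup V] [InnerProductSpace ℝ V] {J K : V →L[ℝ] V} {ε : ℝ}

section Eigenspace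

theorem apply_apply_of_mem_twistorSpace (hJ : J ∈ twistorSpace V) (x : V) : J (J x) = -x :=
  DFunLike.congr_fun hJ.1 x

theorem inner_apply_left_of_mem_twistorSpace (hJ : J ∈ twistorSpace V) (x y : V) :
    ⟪J x, y⟫_ℝ = -⟪x, J y⟫_ℝ := by
  rw [← hJ.2 x (J y), apply_apply_of_mem_twistorSpace hJ, inner_neg_right, neg_neg]

theorem mem_eigenspace_iff {x : V} :
    x ∈ eigenspace J K ε ↔ J (K x) + K (J x) = (2 * ε) • x := by
  simp [eigenspace, sub_eq_zero]

theorem apply_left_mem_eigenspace (hJ : J ∈ twistorSpace V) {x : V} (hx : x ∈ eigenspace J K ε) :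
    J x ∈ eigenspace J K ε := by
  rw [mem_eigenspace_iff] at hx ⊢
  rw [← map_smul, ← hx, map_add, apply_apply_of_mem_twistorSpace hJ,
    apply_apply_of_mem_twistorSpace hJ, map_neg, add_comm]

theorem apply_right_mem_eigenspace (hK : K ∈ twistorSpace V) {x : V} (hx : x ∈ eigenspace J K ε) :
    K x ∈ eigenspace J K ε := by
  rw [mem_eigenspace_iff] at hx ⊢
  rw [← map_smul, ← hx, map_add, apply_apply_of_mem_twistorSpace hK,
    apply_apply_of_mem_twistorSpace hK, map_neg, add_comm]

theorem isComplexStructureOn_eigenspace (hJ : J ∈ twistorSpace V) :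
    IsComplexStructureOn J (eigenspace J K ε) where
  apply_mem _ := apply_left_mem_eigenspace hJ
  apply_apply x _ := apply_apply_of_mem_twistorSpace hJ x
  inner_apply_left x _ y _ := inner_apply_left_of_mem_twistorSpace hJ x y

theorem isOrtho_eigenspace (hJ : J ∈ twistorSpace V) (hK : K ∈ twistorSpace V) {δ : ℝ}
    (h : ε ≠ δ) : eigenspace J K ε ⟂ eigenspace J K δ := by
  rw [Submodule.isOrtho_iff_inner_eq]
  intro x hx y hy
  rw [mem_eigenspace_iff] at hx hy
  have hsymm : (2 * ε) * ⟪x, y⟫_ℝ = (2 * δ) * ⟪x, y⟫_ℝ := by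
    rw [← real_inner_smul_left, ← real_inner_smul_right, ← hx, ← hy, inner_add_left,
      inner_add_right]
    simp only [inner_apply_left_of_mem_twistorSpace hJ, inner_apply_left_of_mem_twistorSpace hK]
    ring
  have hmul : (ε - δ) * ⟪x, y⟫_ℝ = 0 := by linarith
  exact (mul_eq_zero.1 hmul).resolve_left (sub_ne_zero.2 h)

theorem apply_eq_neg_smul_of_mem_eigenspace (hJ : J ∈ twistorSpace V) (hK : K ∈ twistorSpace V)
    (hε : ε ^ 2 = 1) {x : V} (hx : x ∈ eigenspace J K ε) : K x = -(ε • J x) := by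
  rw [mem_eigenspace_iff] at hx
  have hinner : ⟪J (K x) + K (J x), x⟫_ℝ = (2 * ε) * ⟪x, x⟫_ℝ := by rw [hx, real_inner_smul_left]
  rw [inner_add_left, inner_apply_left_of_mem_twistorSpace hJ (K x),
    inner_apply_left_of_mem_twistorSpace hK (J x), real_inner_comm (K x) (J x)] at hinner
  have hself : ⟪K x + ε • J x, K x + ε • J x⟫_ℝ = 0 := by
    rw [inner_add_add_self, real_inner_smul_left, real_inner_smul_right, real_inner_smul_left,
      real_inner_smul_right, hK.2, hJ.2, real_inner_comm (K x) (J x)]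
    linear_combination (-ε) * hinner + (-⟪x, x⟫_ℝ) * hε
  exact eq_neg_of_add_eq_zero_left (inner_self_eq_zero.1 hself)

end Eigenspace

section AnticommutingPartner

/-- The normalized component of `K` that anticommutes with `J` on `eigenspace J K ε`. Together with
`J` it makes this eigenspace quaternionic if `-1 < ε < 1`. -/
noncomputable def anticommutingPartner (J K : V →L[ℝ] V) (ε : ℝ) : V →L[ℝ] V :=
  (√(1 - ε ^ 2))⁻¹ • (K + ε • J)

theorem anticommutingPartner_apply (x : V) :
    anticommutingPartner J K ε x = (√(1 - ε ^ 2))⁻¹ • (K x + ε • J x) := rfl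

theorem sqrt_one_sub_sq_pos (hε : ε ∈ Set.Ioo (-1 : ℝ) 1) : 0 < √(1 - ε ^ 2) :=
  Real.sqrt_pos.2 (by nlinarith [hε.1, hε.2])

theorem apply_add_smul_apply_eq (hε : ε ∈ Set.Ioo (-1 : ℝ) 1) (x : V) :
    K x + ε • J x = √(1 - ε ^ 2) • anticommutingPartner J K ε x := by
  rw [anticommutingPartner_apply, smul_inv_smul₀ (sqrt_one_sub_sq_pos hε).ne']

theorem anticommutingPartner_apply_apply_left (hJ : J ∈ twistorSpace V) {x : V}
    (hx : x ∈ eigenspace J K ε) :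
    anticommutingPartner J K ε (J x) = -J (anticommutingPartner J K ε x) := by
  have hKJ : K (J x) = (2 * ε) • x - J (K x) := eq_sub_of_add_eq' (mem_eigenspace_iff.1 hx)
  simp only [anticommutingPartner_apply, map_smul, map_add, apply_apply_of_mem_twistorSpace hJ, hKJ]
  module

theorem isComplexStructureOn_anticommutingPartner (hJ : J ∈ twistorSpace V)
    (hK : K ∈ twistorSpace V) (hε : ε ∈ Set.Ioo (-1 : ℝ) 1) :
    IsComplexStructureOn (anticommutingPartner J K ε) (eigenspace J K ε) where
  apply_mem x hx := Submodule.smul_mem _ _ (add_mem (apply_right_mem_eigenspace hK hx)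
    (Submodule.smul_mem _ _ (apply_left_mem_eigenspace hJ hx)))
  apply_apply x hx := by
    have hKJ : K (J x) = (2 * ε) • x - J (K x) := eq_sub_of_add_eq' (mem_eigenspace_iff.1 hx)
    have hr : (√(1 - ε ^ 2))⁻¹ * (√(1 - ε ^ 2))⁻¹ * (1 - ε ^ 2) = 1 := by
      have hr2 := Real.mul_self_sqrt (Real.sqrt_pos.1 (sqrt_one_sub_sq_pos hε)).le
      have hr0 := sqrt_one_sub_sq_pos hε
      nth_rewrite 3 [← hr2]
      field_simp
    simp only [anticommutingPartner_apply, map_smul, map_add, apply_apply_of_mem_twistorSpace hJ,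
      apply_apply_of_mem_twistorSpace hK, hKJ]
    calc _ = -((√(1 - ε ^ 2))⁻¹ * (√(1 - ε ^ 2))⁻¹ * (1 - ε ^ 2)) • x := by module
      _ = -x := by rw [hr, neg_one_smul]
  inner_apply_left x _ y _ := by
    simp only [anticommutingPartner_apply, real_inner_smul_left, real_inner_smul_right,
      inner_add_left, inner_add_right, inner_apply_left_of_mem_twistorSpace hJ x,
      inner_apply_left_of_mem_twistorSpace hK x]
    ring

end AnticommutingPartner

end Eigenspaces

section MatrixCoordinates

open Module Matrix

variable {V : Type*} [NormedAddCommGroup V] [InnerProductSpace ℝ V] {ι : Type*} [Fintype ι]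

section FrameMap

variable {J : V →L[ℝ] V} {u : ι → V}

/-- The map `z ↦ ∑ z_a u_a`, where `i` acts on `V` as `J`. -/
noncomputable def frameMap (J : V →L[ℝ] V) (u : ι → V) : (ι → ℂ) →ₗ[ℝ] V where
  toFun z := ∑ a, ((z a).re • u a + (z a).im • J (u a))
  map_add' z w := by
    rw [← Finset.sum_add_distrib]
    refine Finset.sum_congr rfl fun a _ => ?_
    simp only [Pi.add_apply, Complex.add_re, Complex.add_im]
    module
  map_smul' c z := by
    rw [RingHom.id_apply, Finset.smul_sum]
    refine Finset.sum_congr rfl fun a _ => ?_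
    simp only [Pi.smul_apply, Complex.smul_re, Complex.smul_im, smul_eq_mul]
    module

theorem frameMap_apply (z : ι → ℂ) :
    frameMap J u z = ∑ a, ((z a).re • u a + (z a).im • J (u a)) := rfl

theorem frameMap_single [DecidableEq ι] (b : ι) : frameMap J u (Pi.single b 1) = u b := by
  rw [frameMap_apply, Finset.sum_eq_single b]
  · simp
  · intro a _ hab
    simp [Pi.single_eq_of_ne hab]
  · simp

theorem frameMap_comp_equiv {κ : Type*} [Fintype κ] (ε : κ ≃ ι) (z : κ → ℂ) :
    frameMap J (u ∘ ε) z = frameMap J u (z ∘ ε.symm) := by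
  simp only [frameMap_apply, ← ε.sum_comp, Function.comp_apply, Equiv.symm_apply_apply]

theorem apply_frameMap (hJ : J ∈ twistorSpace V) (z : ι → ℂ) :
    J (frameMap J u z) = frameMap J u (Complex.I • z) := by
  rw [frameMap_apply, frameMap_apply, map_sum]
  refine Finset.sum_congr rfl fun a _ => ?_
  rw [map_add, map_smul, map_smul, apply_apply_of_mem_twistorSpace hJ]
  simp only [Pi.smul_apply, smul_eq_mul, Complex.mul_re, Complex.mul_im, Complex.I_re, Complex.I_im]
  module

theorem inner_frameMap (hJ : J ∈ twistorSpace V) (hu : IsUnitaryFrame J u) (z w : ι → ℂ) :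
    ⟪frameMap J u z, frameMap J u w⟫_ℝ = (star z ⬝ᵥ w).re := by
  classical
  have hself := orthonormal_iff_ite.1 hu.1
  have hleft : ∀ a b, ⟪J (u a), u b⟫_ℝ = 0 := fun a b => by
    rw [inner_apply_left_of_mem_twistorSpace hJ, hu.2, neg_zero]
  simp only [frameMap_apply, sum_inner, inner_sum, inner_add_left, inner_add_right,
    real_inner_smul_left, real_inner_smul_right, hJ.2, hself, hleft, hu.2]
  simp [dotProduct, Complex.mul_re, mul_comm]

open scoped ComplexOrder in
theorem frameMap_injective (hJ : J ∈ twistorSpace V) (hu : IsUnitaryFrame J u) :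
    Function.Injective (frameMap J u) := by
  rw [injective_iff_map_eq_zero]
  intro z hz
  have hre := inner_frameMap hJ hu z z
  rw [hz, inner_zero_left] at hre
  refine dotProduct_star_self_eq_zero.1 (Complex.ext hre.symm ?_)
  simp [dotProduct, Complex.mul_im, mul_comm]

end FrameMap

section UnitaryGroup

variable (ι) [DecidableEq ι]

/-- Complex matrices as operators on the Hermitian space `ℂ^ι`, as a real linear isomorphism. -/
noncomputable def matrixToOperator :
    Matrix ι ι ℂ ≃L[ℝ] (EuclideanSpace ℂ ι →L[ℂ] EuclideanSpace ℂ ι) :=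
  ((toEuclideanCLM (n := ι) (𝕜 := ℂ)).toAlgEquiv.toLinearEquiv.restrictScalars
    ℝ).toContinuousLinearEquiv

/-- Unitary matrices as the unitary elements of the C⋆-algebra of operators on `ℂ^ι`. -/
noncomputable def unitaryGroupEquiv :
    unitaryGroup ι ℂ ≃ₜ* unitary (EuclideanSpace ℂ ι →L[ℂ] EuclideanSpace ℂ ι) where
  __ := Unitary.mapEquiv
    { (toEuclideanCLM (n := ι) (𝕜 := ℂ)).toAlgEquiv.toMulEquiv with
      map_star' := map_star (toEuclideanCLM (n := ι) (𝕜 := ℂ)) }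
  continuous_toFun := ((matrixToOperator ι).continuous.comp continuous_subtype_val).subtype_mk _
  continuous_invFun :=
    ((matrixToOperator ι).symm.continuous.comp continuous_subtype_val).subtype_mk _

theorem compactSpace_unitaryGroup : CompactSpace (unitaryGroup ι ℂ) :=
  have : CompactSpace (unitary (EuclideanSpace ℂ ι →L[ℂ] EuclideanSpace ℂ ι)) :=
    isCompact_iff_compactSpace.1 isCompact_unitary
  (unitaryGroupEquiv ι).symm.toHomeomorph.compactSpace

end UnitaryGroup

section MatrixHom

variable [FiniteDimensional ℝ V] {J : V →L[ℝ] V} {u : ι → V}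
  (hJ : J ∈ twistorSpace V) (hu : IsUnitaryFrame J u) (hn : finrank ℝ V = 2 * Fintype.card ι)

/-- The linear coordinates on `V` given by a unitary frame of full length. -/
noncomputable def frameEquiv : (ι → ℂ) ≃ₗ[ℝ] V :=
  LinearEquiv.ofInjectiveOfFinrankEq (frameMap J u) (frameMap_injective hJ hu) (by
    rw [hn, finrank_pi_fintype]
    simp [Complex.finrank_real_complex, mul_comm])

theorem frameEquiv_apply (z : ι → ℂ) : frameEquiv hJ hu hn z = frameMap J u z := rfl

theorem frameMap_surjective (hJ : J ∈ twistorSpace V) (hu : IsUnitaryFrame J u)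
    (hn : finrank ℝ V = 2 * Fintype.card ι) : Function.Surjective (frameMap J u) :=
  (frameEquiv hJ hu hn).surjective

variable [DecidableEq ι]

/-- Matrices as endomorphisms of `V`, by means of a unitary frame of full length. -/
noncomputable def matrixHom : Matrix ι ι ℂ →ₐ[ℝ] (V →L[ℝ] V) :=
  AlgHom.ofLinearMap
    { toFun := fun A => LinearMap.toContinuousLinearMap ((frameEquiv hJ hu hn).toLinearMap ∘ₗ
        A.mulVecLin.restrictScalars ℝ ∘ₗ (frameEquiv hJ hu hn).symm.toLinearMap)
      map_add' := fun A B => by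
        ext x
        simp
      map_smul' := fun c A => by
        ext x
        simp }
    (by
      ext x
      simp)
    (fun A B => by
      ext x
      simp [mulVec_mulVec])

theorem matrixHom_frameMap (A : Matrix ι ι ℂ) (z : ι → ℂ) :
    matrixHom hJ hu hn A (frameMap J u z) = frameMap J u (A *ᵥ z) := by
  rw [← frameEquiv_apply hJ hu hn, ← frameEquiv_apply hJ hu hn]
  simp [matrixHom]

theorem matrixHom_apply_frame (A : Matrix ι ι ℂ) (b : ι) :
    matrixHom hJ hu hn A (u b) = frameMap J u (A.col b) := by
  rw [← frameMap_single (J := J) (u := u) b, matrixHom_frameMap, mulVec_single_one]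

theorem matrixHom_injective : Function.Injective (matrixHom hJ hu hn) := by
  intro A B hAB
  refine Matrix.ext_of_mulVec_single fun b => frameMap_injective hJ hu ?_
  rw [← matrixHom_frameMap hJ hu hn, hAB, matrixHom_frameMap]

theorem matrixHom_comp_equiv {κ : Type*} [Fintype κ] [DecidableEq κ] (ε : κ ≃ ι)
    (huε : IsUnitaryFrame J (u ∘ ε)) (hκ : finrank ℝ V = 2 * Fintype.card κ)
    (A : Matrix κ κ ℂ) :
    matrixHom hJ huε hκ A = matrixHom hJ hu hn (A.submatrix ε.symm ε.symm) := by
  refine ContinuousLinearMap.ext fun x => ?_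
  obtain ⟨z, rfl⟩ := frameMap_surjective hJ huε hκ x
  rw [matrixHom_frameMap, frameMap_comp_equiv, frameMap_comp_equiv, matrixHom_frameMap,
    submatrix_mulVec_equiv]
  simp [Function.comp_assoc]

theorem commute_matrixHom (A : Matrix ι ι ℂ) : Commute (matrixHom hJ hu hn A) J := by
  refine ContinuousLinearMap.ext fun x => ?_
  obtain ⟨z, rfl⟩ := frameMap_surjective hJ hu hn x
  simp only [mul_apply_eq_comp]
  rw [apply_frameMap hJ, matrixHom_frameMap, matrixHom_frameMap, apply_frameMap hJ, mulVec_smul]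

theorem eq_matrixHom_of_commute {T : V →L[ℝ] V} (hTJ : Commute T J) {A : Matrix ι ι ℂ}
    (hA : ∀ b, T (u b) = frameMap J u (A.col b)) : T = matrixHom hJ hu hn A := by
  refine ContinuousLinearMap.ext fun x => ?_
  obtain ⟨z, rfl⟩ := frameMap_surjective hJ hu hn x
  have hT : ∀ y, T (J y) = J (T y) := DFunLike.congr_fun hTJ
  have hAJ : ∀ y, matrixHom hJ hu hn A (J y) = J (matrixHom hJ hu hn A y) :=
    DFunLike.congr_fun (commute_matrixHom hJ hu hn A)
  rw [frameMap_apply, map_sum, map_sum]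
  refine Finset.sum_congr rfl fun a _ => ?_
  simp only [map_add, map_smul, hT, hAJ, hA, matrixHom_apply_frame]

theorem exists_matrixHom_eq {T : V →L[ℝ] V} (hTJ : Commute T J) :
    ∃ A, matrixHom hJ hu hn A = T := by
  choose z hz using fun b => frameMap_surjective hJ hu hn (T (u b))
  exact ⟨Matrix.of fun a b => z b a,
    (eq_matrixHom_of_commute hJ hu hn hTJ fun b => (hz b).symm).symm⟩

theorem inner_matrixHom_left (A : Matrix ι ι ℂ) (x y : V) :
    ⟪matrixHom hJ hu hn A x, y⟫_ℝ = ⟪x, matrixHom hJ hu hn (star A) y⟫_ℝ := by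
  obtain ⟨z, rfl⟩ := frameMap_surjective hJ hu hn x
  obtain ⟨w, rfl⟩ := frameMap_surjective hJ hu hn y
  rw [matrixHom_frameMap, matrixHom_frameMap, inner_frameMap hJ hu, inner_frameMap hJ hu,
    star_mulVec, ← dotProduct_mulVec, star_eq_conjTranspose]

theorem forall_inner_matrixHom_iff {A : Matrix ι ι ℂ} :
    (∀ x y, ⟪matrixHom hJ hu hn A x, matrixHom hJ hu hn A y⟫_ℝ = ⟪x, y⟫_ℝ) ↔
      A ∈ unitaryGroup ι ℂ := by
  simp only [inner_matrixHom_left, ← mul_apply_eq_comp, ← map_mul, mem_unitaryGroup_iff']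
  refine ⟨fun h => matrixHom_injective hJ hu hn (ContinuousLinearMap.ext fun y => ?_), fun h => ?_⟩
  · exact ext_inner_left ℝ fun x => by rw [h x y, map_one, one_apply_eq_self]
  · simp [h]

/-- The homomorphism from `U(n)` to `U(J)` given by a unitary frame of full length. -/
noncomputable def unitaryHom : unitaryGroup ι ℂ →* unitaryOf J :=
  ((Units.map (matrixHom hJ hu hn : Matrix ι ι ℂ →* (V →L[ℝ] V))).comp
    Unitary.toUnits).codRestrict (unitaryOf J) fun g =>
      ⟨(forall_inner_matrixHom_iff hJ hu hn).2 g.2, commute_matrixHom hJ hu hn g.1⟩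

theorem coe_unitaryHom (g : unitaryGroup ι ℂ) :
    ((unitaryHom hJ hu hn g : (V →L[ℝ] V)ˣ) : V →L[ℝ] V) = matrixHom hJ hu hn g := rfl

theorem unitaryHom_bijective : Function.Bijective (unitaryHom hJ hu hn) := by
  constructor
  · intro g h hgh
    refine Subtype.ext (matrixHom_injective hJ hu hn ?_)
    rw [← coe_unitaryHom, hgh, coe_unitaryHom]
  · rintro ⟨T, hT, hTJ⟩
    obtain ⟨A, hA⟩ := exists_matrixHom_eq hJ hu hn hTJ
    rw [← hA, forall_inner_matrixHom_iff] at hT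
    exact ⟨⟨A, hT⟩, Subtype.ext (Units.ext hA)⟩

theorem continuous_matrixHom : Continuous (matrixHom hJ hu hn) :=
  (matrixHom hJ hu hn).toLinearMap.continuous_of_finiteDimensional

theorem continuous_unitaryHom : Continuous (unitaryHom hJ hu hn) := by
  refine Continuous.subtype_mk (Units.continuous_iff.2 ⟨?_, ?_⟩) _
  · exact (continuous_matrixHom hJ hu hn).comp continuous_subtype_val
  · exact (continuous_matrixHom hJ hu hn).comp (continuous_subtype_val.comp continuous_inv)

/-- The isomorphism of topological groups from `U(n)` to `U(J)` given by a unitary frame of full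
length. -/
noncomputable def unitaryEquiv : unitaryGroup ι ℂ ≃ₜ* unitaryOf J where
  __ := MulEquiv.ofBijective _ (unitaryHom_bijective hJ hu hn)
  continuous_toFun := continuous_unitaryHom hJ hu hn
  continuous_invFun :=
    have := compactSpace_unitaryGroup ι
    (Continuous.homeoOfEquivCompactToT2
      (f := (MulEquiv.ofBijective _ (unitaryHom_bijective hJ hu hn)).toEquiv)
      (continuous_unitaryHom hJ hu hn)).symm.continuous

end MatrixHom

section Orbit

variable [DecidableEq ι] [FiniteDimensional ℝ V] {J : V →L[ℝ] V} {u : ι → V}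
  (hJ : J ∈ twistorSpace V) (hu : IsUnitaryFrame J u) (hn : finrank ℝ V = 2 * Fintype.card ι)

theorem exists_smoothStructure_orbit_unitaryOf {K : V →L[ℝ] V} {H : Subgroup (unitaryGroup ι ℂ)}
    (hH : ∀ g, g ∈ H ↔ Commute (matrixHom hJ hu hn g) K) :
    ∃ (c d : ℕ) (_ : ChartedSpace (EuclideanSpace ℝ (Fin c)) (unitaryGroup ι ℂ))
      (_ : ChartedSpace (EuclideanSpace ℝ (Fin d)) (unitaryGroup ι ℂ ⧸ H))
      (_ : ChartedSpace (EuclideanSpace ℝ (Fin d)) (orbit J K)),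
      IsEmbeddedSubmanifold c (Subtype.val : unitaryGroup ι ℂ → Matrix ι ι ℂ) ∧
      IsQuotientManifold c H d ∧ IsEmbeddedSubmanifold d (Subtype.val : orbit J K → V →L[ℝ] V) ∧
      ∃ Φ : Diffeomorph (𝓡 d) (𝓡 d) (unitaryGroup ι ℂ ⧸ H) (orbit J K) ∞,
        ∀ g : unitaryGroup ι ℂ, (Φ g : V →L[ℝ] V) =
          ((unitaryEquiv hJ hu hn g : (V →L[ℝ] V)ˣ) : V →L[ℝ] V) * K *
            ((unitaryEquiv hJ hu hn g : (V →L[ℝ] V)ˣ)⁻¹ : (V →L[ℝ] V)ˣ) := by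
  let _ : DistribMulAction (unitaryGroup ι ℂ) (V →L[ℝ] V) :=
    DistribMulAction.compHom _ ((ConjAct.toConjAct.toMonoidHom.comp (unitaryOf J).subtype).comp
      (unitaryEquiv hJ hu hn).toMonoidHom)
  let α : (EuclideanSpace ℂ ι →L[ℂ] EuclideanSpace ℂ ι) →ₐ[ℝ] (V →L[ℝ] V) :=
    (matrixHom hJ hu hn).comp
      ((toEuclideanCLM (n := ι) (𝕜 := ℂ)).toAlgEquiv.restrictScalars ℝ).symm.toAlgHom
  have hα : ∀ g, α (unitaryGroupEquiv ι g) = matrixHom hJ hu hn g := fun g =>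
    congrArg (matrixHom hJ hu hn) (toEuclideanCLM.symm_apply_apply g.1)
  have hsmul : ∀ (g : unitaryGroup ι ℂ) (b : V →L[ℝ] V), g • b =
      α (unitaryGroupEquiv ι g) * b * α (star (unitaryGroupEquiv ι g : _ →L[ℂ] _)) := fun g b => by
    rw [hα, ← Unitary.coe_star, Unitary.star_eq_inv, ← map_inv, hα]
    rfl
  have : SMulCommClass (unitaryGroup ι ℂ) ℝ (V →L[ℝ] V) :=
    ⟨fun g r b => by simp only [hsmul, mul_smul_comm, smul_mul_assoc]⟩
  have : ContinuousConstSMul (unitaryGroup ι ℂ) (V →L[ℝ] V) :=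
    ⟨fun g => by simp only [hsmul]; fun_prop⟩
  have hstab : H = MulAction.stabilizer (unitaryGroup ι ℂ) K := by
    ext g
    rw [hH, MulAction.mem_stabilizer_iff]
    exact (Units.mul_inv_eq_iff_eq_mul (unitaryEquiv hJ hu hn g : (V →L[ℝ] V)ˣ)).symm
  have horbit : orbit J K = MulAction.orbit (unitaryGroup ι ℂ) K :=
    ((unitaryEquiv hJ hu hn).surjective.range_comp _).symm
  rw [hstab, horbit]
  have hi : ∀ g : unitaryGroup ι ℂ,
      (g : Matrix ι ι ℂ) = (matrixToOperator ι).symm (unitaryGroupEquiv ι g) :=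
    fun g => ((matrixToOperator ι).symm_apply_apply g.1).symm
  exact exists_smoothStructure_orbit (matrixToOperator ι).symm hi hsmul K

end Orbit

end MatrixCoordinates

section Commutant

open Module

variable {V : Type*} [NormedAddCommGroup V] [InnerProductSpace ℝ V] {J K : V →L[ℝ] V}

section AntilinearPart

/-- The `J`-linear operator `(JK + KJ) / 2`, which is multiplication by `ε` on
`eigenspace J K ε`. -/
noncomputable def halfAnticommutator (J K : V →L[ℝ] V) : V →L[ℝ] V := (2 : ℝ)⁻¹ • (J * K + K * J)

/-- The `J`-antilinear part of `K`: if `J² = -1`, it is `(K + JKJ) / 2`. -/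
noncomputable def antilinearPart (J K : V →L[ℝ] V) : V →L[ℝ] V := K + halfAnticommutator J K * J

theorem halfAnticommutator_apply_of_mem {ε : ℝ} {x : V} (hx : x ∈ eigenspace J K ε) :
    halfAnticommutator J K x = ε • x := by
  rw [mem_eigenspace_iff] at hx
  simp only [halfAnticommutator, smul_apply, add_apply, mul_apply_eq_comp, hx]
  module

theorem commute_halfAnticommutator (hJ : J ∈ twistorSpace V) :
    Commute (halfAnticommutator J K) J := by
  refine ContinuousLinearMap.ext fun x => ?_
  simp [halfAnticommutator, apply_apply_of_mem_twistorSpace hJ, add_comm]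

theorem antilinearPart_apply_of_mem (hJ : J ∈ twistorSpace V) {ε : ℝ} {x : V}
    (hx : x ∈ eigenspace J K ε) : antilinearPart J K x = K x + ε • J x := by
  simp [antilinearPart, halfAnticommutator_apply_of_mem (apply_left_mem_eigenspace hJ hx)]

theorem antilinearPart_apply_apply (hJ : J ∈ twistorSpace V) (x : V) :
    antilinearPart J K (J x) = -J (antilinearPart J K x) := by
  simp only [antilinearPart, halfAnticommutator, add_apply, mul_apply_eq_comp,
    smul_apply, map_add, map_smul, map_neg, apply_apply_of_mem_twistorSpace hJ]
  module

theorem commute_iff_of_commute_left {B : V →L[ℝ] V} (hB : Commute B J) :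
    Commute B K ↔ Commute B (halfAnticommutator J K) ∧ Commute B (antilinearPart J K) := by
  refine ⟨fun h => ?_, fun ⟨hΛ, hT⟩ => ?_⟩
  · have hΛ : Commute B (halfAnticommutator J K) :=
      ((hB.mul_right h).add_right (h.mul_right hB)).smul_right _
    exact ⟨hΛ, h.add_right (hΛ.mul_right hB)⟩
  · have hK := hT.sub_right (hΛ.mul_right hB)
    rwa [antilinearPart, add_sub_cancel_right] at hK

end AntilinearPart

section CommuteMatrixHom

open Matrix

variable {ι : Type*} [Fintype ι] {u : ι → V}

theorem frameMap_smul (hJ : J ∈ twistorSpace V) (c : ℂ) (z : ι → ℂ) :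
    frameMap J u (c • z) = c.re • frameMap J u z + c.im • J (frameMap J u z) := by
  rw [apply_frameMap hJ, ← map_smul, ← map_smul, ← map_add]
  congr 1
  ext a
  simp only [Pi.add_apply, Pi.smul_apply, smul_eq_mul, Complex.real_smul, ← mul_assoc, ← add_mul,
    Complex.re_add_im]

theorem apply_frameMap_of_anticommute (hJ : J ∈ twistorSpace V) {T : V →L[ℝ] V}
    (hTJ : ∀ x, T (J x) = -J (T x)) {S : Matrix ι ι ℂ}
    (hS : ∀ b, T (u b) = frameMap J u (S.col b)) (z : ι → ℂ) :
    T (frameMap J u z) = frameMap J u (S *ᵥ star z) := by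
  have hmulVec : S *ᵥ star z = ∑ b, star (z b) • S.col b := by
    ext a
    simp [mulVec, dotProduct, mul_comm]
  rw [hmulVec, map_sum, frameMap_apply, map_sum]
  refine Finset.sum_congr rfl fun b _ => ?_
  simp [frameMap_smul hJ, hTJ, hS]

variable [DecidableEq ι] [FiniteDimensional ℝ V] (hJ : J ∈ twistorSpace V)
  (hu : IsUnitaryFrame J u) (hn : finrank ℝ V = 2 * Fintype.card ι)

theorem commute_matrixHom_iff_of_commute {T : V →L[ℝ] V} (hTJ : Commute T J) {A S : Matrix ι ι ℂ}
    (hS : ∀ b, T (u b) = frameMap J u (S.col b)) :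
    Commute (matrixHom hJ hu hn A) T ↔ Commute A S := by
  rw [eq_matrixHom_of_commute hJ hu hn hTJ hS]
  exact commute_map_iff (matrixHom_injective hJ hu hn)

theorem commute_matrixHom_iff_of_anticommute {T : V →L[ℝ] V} (hTJ : ∀ x, T (J x) = -J (T x))
    {A S : Matrix ι ι ℂ} (hS : ∀ b, T (u b) = frameMap J u (S.col b)) :
    Commute (matrixHom hJ hu hn A) T ↔ A * S = S * A.map star := by
  have hT := apply_frameMap_of_anticommute hJ hTJ hS
  have hstar : ∀ z, star (A *ᵥ z) = A.map star *ᵥ star z := fun z => by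
    ext a
    simp [mulVec, dotProduct]
  rw [commute_iff_eq, ContinuousLinearMap.ext_iff, (frameMap_surjective hJ hu hn).forall]
  simp only [mul_apply_eq_comp, hT, matrixHom_frameMap, hstar, mulVec_mulVec]
  refine ⟨fun h => Matrix.ext_of_mulVec_single fun b => ?_, fun h z => by rw [h]⟩
  simpa using frameMap_injective hJ hu (h (Pi.single b 1))

theorem commute_matrixHom_iff {d : ι → ℝ} (hd : ∀ b, u b ∈ eigenspace J K (d b))
    {A S : Matrix ι ι ℂ} (hS : ∀ b, K (u b) + d b • J (u b) = frameMap J u (S.col b)) :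
    Commute (matrixHom hJ hu hn A) K ↔
      (∀ a b, d a ≠ d b → A a b = 0) ∧ A * S = S * A.map star := by
  have hΛ : ∀ b, halfAnticommutator J K (u b) =
      frameMap J u ((diagonal fun b => (d b : ℂ)).col b) := fun b => by
    rw [halfAnticommutator_apply_of_mem (hd b), ← mulVec_single_one, diagonal_mulVec_single,
      mul_one, ← frameMap_single (J := J) (u := u) b, ← map_smul, ← Pi.single_smul,
      Complex.real_smul, mul_one]
  have hdiag : Commute A (diagonal fun b => (d b : ℂ)) ↔ ∀ a b, d a ≠ d b → A a b = 0 := by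
    simp only [commute_iff_eq, ← Matrix.ext_iff, mul_diagonal, diagonal_mul]
    refine forall₂_congr fun a b => ?_
    rw [mul_comm, eq_comm, mul_eq_mul_right_iff, Complex.ofReal_inj, or_iff_not_imp_left]
  rw [commute_iff_of_commute_left (commute_matrixHom hJ hu hn A),
    commute_matrixHom_iff_of_commute hJ hu hn (commute_halfAnticommutator hJ) hΛ, hdiag,
    commute_matrixHom_iff_of_anticommute hJ hu hn (antilinearPart_apply_apply hJ)
      fun b => (antilinearPart_apply_of_mem hJ (hd b)).trans (hS b)]

end CommuteMatrixHom

end Commutant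

section BlockMatrices

open Matrix

variable {l n : ℕ} {k : Fin l → ℕ} {m₁ m₂ : ℕ}

/-- The diagonal block to which an index belongs, labelled as in `eigenspaces`. -/
def blockOf : BlockIndex k m₁ m₂ → Fin l ⊕ Fin 2 :=
  Sum.elim (fun p => .inl p.1) (Sum.elim (fun _ => .inr 0) fun _ => .inr 1)

theorem blockMatrix_map_star
    (X : ∀ i, Matrix (Fin (k i) ⊕ Fin (k i)) (Fin (k i) ⊕ Fin (k i)) ℂ)
    (B : Matrix (Fin m₁) (Fin m₁) ℂ) (C : Matrix (Fin m₂) (Fin m₂) ℂ) :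
    (blockMatrix X B C).map star = blockMatrix (fun i => (X i).map star) (B.map star)
      (C.map star) := by
  simp [blockMatrix, fromBlocks_map, blockDiagonal'_map]

theorem blockMatrix_inj
    {X X' : ∀ i, Matrix (Fin (k i) ⊕ Fin (k i)) (Fin (k i) ⊕ Fin (k i)) ℂ}
    {B B' : Matrix (Fin m₁) (Fin m₁) ℂ} {C C' : Matrix (Fin m₂) (Fin m₂) ℂ} :
    blockMatrix X B C = blockMatrix X' B' C' ↔ X = X' ∧ B = B' ∧ C = C' := by
  simp [blockMatrix, fromBlocks_inj, blockDiagonal'_inj]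

theorem blockMatrix_mem_unitaryGroup_iff
    {X : ∀ i, Matrix (Fin (k i) ⊕ Fin (k i)) (Fin (k i) ⊕ Fin (k i)) ℂ}
    {B : Matrix (Fin m₁) (Fin m₁) ℂ} {C : Matrix (Fin m₂) (Fin m₂) ℂ} :
    blockMatrix X B C ∈ unitaryGroup (BlockIndex k m₁ m₂) ℂ ↔
      (∀ i, X i ∈ unitaryGroup _ ℂ) ∧ B ∈ unitaryGroup _ ℂ ∧ C ∈ unitaryGroup _ ℂ := by
  simp only [mem_unitaryGroup_iff]
  rw [blockMatrix_star, ← blockMatrix_mul, ← blockMatrix_one, blockMatrix_inj, funext_iff]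

theorem blockMatrix_apply_of_blockOf_ne
    (X : ∀ i, Matrix (Fin (k i) ⊕ Fin (k i)) (Fin (k i) ⊕ Fin (k i)) ℂ)
    (B : Matrix (Fin m₁) (Fin m₁) ℂ) (C : Matrix (Fin m₂) (Fin m₂) ℂ)
    {a b : BlockIndex k m₁ m₂} (hab : blockOf a ≠ blockOf b) : blockMatrix X B C a b = 0 := by
  rcases a with ⟨i, x⟩ | a | a <;> rcases b with ⟨j, y⟩ | b | b <;>
    simp_all [blockOf, blockMatrix, blockDiagonal'_apply]

theorem exists_eq_blockMatrix {A : Matrix (BlockIndex k m₁ m₂) (BlockIndex k m₁ m₂) ℂ}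
    (hA : ∀ a b, blockOf a ≠ blockOf b → A a b = 0) : ∃ X B C, A = blockMatrix X B C := by
  refine ⟨fun i => of fun x y => A (.inl ⟨i, x⟩) (.inl ⟨i, y⟩),
    of fun x y => A (.inr (.inl x)) (.inr (.inl y)),
    of fun x y => A (.inr (.inr x)) (.inr (.inr y)), ?_⟩
  ext a b
  by_cases hab : blockOf a = blockOf b
  · rcases a with ⟨i, x⟩ | a | a <;> rcases b with ⟨j, y⟩ | b | b <;>
      simp only [blockOf, Sum.elim_inl, Sum.elim_inr, Sum.inl.injEq, Sum.inr.injEq, reduceCtorEq,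
        zero_ne_one, one_ne_zero] at hab
    · subst hab
      simp [blockMatrix]
    · rfl
    · rfl
  · rw [hA a b hab, blockMatrix_apply_of_blockOf_ne _ _ _ hab]

/-- For unitary matrices, being symplectic means commuting with the quaternionic structure
`z ↦ J z̄`. -/
theorem mem_symplecticGroup_iff_of_mem_unitaryGroup {ι : Type*} [Fintype ι] [DecidableEq ι]
    {X : Matrix (ι ⊕ ι) (ι ⊕ ι) ℂ} (hX : X ∈ unitaryGroup (ι ⊕ ι) ℂ) :
    X ∈ symplecticGroup ι ℂ ↔ X * J ι ℂ = J ι ℂ * X.map star := by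
  have hmul : X.map star * Xᵀ = 1 := by
    have := congrArg transpose (mem_unitaryGroup_iff.1 hX)
    rwa [transpose_mul, transpose_one] at this
  have hmul' : Xᵀ * X.map star = 1 := mul_eq_one_comm.1 hmul
  rw [SymplecticGroup.mem_iff]
  refine ⟨fun h => ?_, fun h => by rw [h, mul_assoc, hmul, mul_one]⟩
  rw [← h, mul_assoc _ Xᵀ, hmul', mul_one, h]

/-- The matrix of an antilinear operator which is `s_i` times the standard quaternionic structure
on the `i`-th block of even size and vanishes on the last two blocks. -/
noncomputable def quaternionMatrix (s : Fin l → ℝ) :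
    Matrix (BlockIndex k m₁ m₂) (BlockIndex k m₁ m₂) ℂ :=
  blockMatrix (fun i => (s i : ℂ) • J (Fin (k i)) ℂ) 0 0

theorem quaternionMatrix_col_inl_inl (s : Fin l → ℝ) (i : Fin l) (x : Fin (k i)) :
    (quaternionMatrix s : Matrix (BlockIndex k m₁ m₂) _ ℂ).col (.inl ⟨i, .inl x⟩) =
      s i • Pi.single (.inl ⟨i, .inr x⟩) 1 := by
  ext (⟨j, y⟩ | a | a)
  · rcases eq_or_ne j i with rfl | hji
    · rcases y with y | y <;>
        simp [quaternionMatrix, blockMatrix, J, one_apply, Pi.single_apply]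
    · simp [quaternionMatrix, blockMatrix, blockDiagonal'_apply_ne _ _ _ hji, hji]
  · simp [quaternionMatrix, blockMatrix]
  · simp [quaternionMatrix, blockMatrix]

theorem quaternionMatrix_col_inl_inr (s : Fin l → ℝ) (i : Fin l) (x : Fin (k i)) :
    (quaternionMatrix s : Matrix (BlockIndex k m₁ m₂) _ ℂ).col (.inl ⟨i, .inr x⟩) =
      -(s i • Pi.single (.inl ⟨i, .inl x⟩) 1) := by
  ext (⟨j, y⟩ | a | a)
  · rcases eq_or_ne j i with rfl | hji
    · rcases y with y | y <;>
        simp [quaternionMatrix, blockMatrix, J, one_apply, Pi.single_apply]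
    · simp [quaternionMatrix, blockMatrix, blockDiagonal'_apply_ne _ _ _ hji, hji]
  · simp [quaternionMatrix, blockMatrix]
  · simp [quaternionMatrix, blockMatrix]

theorem quaternionMatrix_col_inr (s : Fin l → ℝ) (x : Fin m₁ ⊕ Fin m₂) :
    (quaternionMatrix s : Matrix (BlockIndex k m₁ m₂) _ ℂ).col (.inr x) = 0 := by
  ext a
  rcases a with a | a | a <;> rcases x with x | x <;> rfl

theorem blockMatrix_mul_quaternionMatrix_iff {s : Fin l → ℝ} (hs : ∀ i, s i ≠ 0)
    (X : ∀ i, Matrix (Fin (k i) ⊕ Fin (k i)) (Fin (k i) ⊕ Fin (k i)) ℂ)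
    (B : Matrix (Fin m₁) (Fin m₁) ℂ) (C : Matrix (Fin m₂) (Fin m₂) ℂ) :
    blockMatrix X B C * quaternionMatrix s = quaternionMatrix s * (blockMatrix X B C).map star ↔
      ∀ i, X i * J (Fin (k i)) ℂ = J (Fin (k i)) ℂ * (X i).map star := by
  rw [blockMatrix_map_star, quaternionMatrix, ← blockMatrix_mul, ← blockMatrix_mul,
    blockMatrix_inj, funext_iff]
  simp only [Matrix.mul_smul, Matrix.smul_mul, Matrix.mul_zero, Matrix.zero_mul, and_true]
  exact forall_congr' fun i =>
    (smul_right_injective _ (Complex.ofReal_ne_zero.2 (hs i))).eq_iff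

theorem mem_blockSubgroup_iff (ε : BlockIndex k m₁ m₂ ≃ Fin n) {s : Fin l → ℝ}
    (hs : ∀ i, s i ≠ 0) (g : unitaryGroup (Fin n) ℂ) :
    g ∈ blockSubgroup ε ↔
      (∀ a b, blockOf a ≠ blockOf b → g.1.submatrix ε ε a b = 0) ∧
        g.1.submatrix ε ε * quaternionMatrix s =
          quaternionMatrix s * (g.1.submatrix ε ε).map star := by
  constructor
  · rintro ⟨⟨X, B, C⟩, rfl⟩
    have hg : (blockHom ε (X, B, C)).1.submatrix ε ε =
        blockMatrix (fun i => (X i).1.1) B.1 C.1 := by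
      ext
      simp [blockHom]
    rw [hg, blockMatrix_mul_quaternionMatrix_iff hs]
    exact ⟨fun _ _ => blockMatrix_apply_of_blockOf_ne _ _ _,
      fun i => (mem_symplecticGroup_iff_of_mem_unitaryGroup (X i).1.2).1 (X i).2⟩
  · rintro ⟨hblock, hsymp⟩
    obtain ⟨X, B, C, hA⟩ := exists_eq_blockMatrix hblock
    have hu : blockMatrix X B C ∈ unitaryGroup (BlockIndex k m₁ m₂) ℂ := by
      rw [← hA, mem_unitaryGroup_iff, star_eq_conjTranspose, conjTranspose_submatrix,
        submatrix_mul_equiv, ← star_eq_conjTranspose, mem_unitaryGroup_iff.1 g.2,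
        submatrix_one_equiv]
    obtain ⟨hX, hB, hC⟩ := blockMatrix_mem_unitaryGroup_iff.1 hu
    rw [hA, blockMatrix_mul_quaternionMatrix_iff hs] at hsymp
    refine ⟨(fun i => ⟨⟨X i, hX i⟩, (mem_symplecticGroup_iff_of_mem_unitaryGroup (hX i)).2
      (hsymp i)⟩, ⟨B, hB⟩, ⟨C, hC⟩), Subtype.ext ?_⟩
    simp [blockHom, ← hA]

end BlockMatrices

section AdaptedFrames

open Module

variable {V : Type*} [NormedAddCommGroup V] [InnerProductSpace ℝ V]
  {J K : V →L[ℝ] V} {l : ℕ} {e : Fin l → ℝ} {k : Fin l → ℕ} {m₁ m₂ : ℕ}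

/-- The values `e_1, …, e_l, 1, -1`, indexed as the subspaces in `eigenspaces`. -/
def eigenvalues (e : Fin l → ℝ) : Fin l ⊕ Fin 2 → ℝ :=
  Sum.elim e ![1, -1]

theorem eigenspaces_eq_eigenspace (i : Fin l ⊕ Fin 2) :
    eigenspaces J K e i = eigenspace J K (eigenvalues e i) := by
  rcases i with i | i
  · rfl
  · fin_cases i <;> rfl

theorem mem_eigenspaces_iff {i : Fin l ⊕ Fin 2} {x : V} :
    x ∈ eigenspaces J K e i ↔ x ∈ eigenspace J K (eigenvalues e i) := by
  rw [eigenspaces_eq_eigenspace]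

theorem isOrtho_eigenspaces (hJ : J ∈ twistorSpace V) (hK : K ∈ twistorSpace V)
    (hV : DirectSum.IsInternal (eigenspaces J K e)) {i j : Fin l ⊕ Fin 2} (hij : i ≠ j) :
    eigenspaces J K e i ⟂ eigenspaces J K e j := by
  by_cases h : eigenvalues e i = eigenvalues e j
  · have hdisj := hV.submodule_iSupIndep.pairwiseDisjoint hij
    rw [Function.onFun, eigenspaces_eq_eigenspace, eigenspaces_eq_eigenspace, h,
      disjoint_self] at hdisj
    rw [eigenspaces_eq_eigenspace j, hdisj]
    exact Submodule.isOrtho_bot_right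
  · rw [eigenspaces_eq_eigenspace, eigenspaces_eq_eigenspace]
    exact isOrtho_eigenspace hJ hK h

theorem finrank_eq_two_mul_card_blockIndex [FiniteDimensional ℝ V]
    (hV : DirectSum.IsInternal (eigenspaces J K e))
    (hk : ∀ i, finrank ℝ (eigenspace J K (e i)) = 4 * k i)
    (hm₁ : finrank ℝ (eigenspace J K 1) = 2 * m₁)
    (hm₂ : finrank ℝ (eigenspace J K (-1)) = 2 * m₂) :
    finrank ℝ V = 2 * Fintype.card (BlockIndex k m₁ m₂) := by
  calc finrank ℝ V = ∑ i, finrank ℝ (eigenspaces J K e i) := by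
        rw [← finrank_directSum]
        exact (LinearEquiv.ofBijective (DirectSum.coeLinearMap _) hV).finrank_eq.symm
    _ = ∑ i, 4 * k i + (2 * m₁ + 2 * m₂) := by
        rw [Fintype.sum_sum_type, Fin.sum_univ_two, ← hm₁, ← hm₂]
        exact congrArg (· + _) (Finset.sum_congr rfl fun i _ => hk i)
    _ = 2 * Fintype.card (BlockIndex k m₁ m₂) := by
        simp only [Fintype.card_sum, Fintype.card_sigma, Fintype.card_fin, mul_add, Finset.mul_sum]
        congr 1
        exact Finset.sum_congr rfl fun i _ => by ring

/-- A unitary frame adapted to the decomposition of `V` into the spaces `V_{e_i}` and `V_{±1}`: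
each vector lies in the subspace labelled by its block, and there `K` is `-e_i J` plus a multiple
of a quaternionic partner of `J` which has the standard matrix. -/
structure IsAdaptedFrame (J K : V →L[ℝ] V) (e : Fin l → ℝ) (v : BlockIndex k m₁ m₂ → V) :
    Prop where
  isUnitaryFrame : IsUnitaryFrame J v
  mem_eigenspaces (a) : v a ∈ eigenspaces J K e (blockOf a)
  apply_add_smul (a) : K (v a) + eigenvalues e (blockOf a) • J (v a) =
    frameMap J v ((quaternionMatrix fun i => √(1 - e i ^ 2)).col a)

/-- The family on all blocks assembled from families on the individual blocks. -/
def blockFamily (q : ∀ i, Fin (k i) ⊕ Fin (k i) → V) (p₁ : Fin m₁ → V) (p₂ : Fin m₂ → V) :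
    BlockIndex k m₁ m₂ → V :=
  Sum.elim (fun p => q p.1 p.2) (Sum.elim p₁ p₂)

section Assembly

variable {q : ∀ i, Fin (k i) ⊕ Fin (k i) → V} {p₁ : Fin m₁ → V} {p₂ : Fin m₂ → V}

theorem blockFamily_mem_eigenspaces (hq : ∀ i a, q i a ∈ eigenspace J K (e i))
    (hp₁ : ∀ a, p₁ a ∈ eigenspace J K 1) (hp₂ : ∀ a, p₂ a ∈ eigenspace J K (-1)) :
    ∀ a, blockFamily q p₁ p₂ a ∈ eigenspaces J K e (blockOf a)
  | .inl ⟨i, a⟩ => hq i a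
  | .inr (.inl a) => hp₁ a
  | .inr (.inr a) => hp₂ a

theorem isUnitaryFrame_blockFamily (hJ : J ∈ twistorSpace V) (hK : K ∈ twistorSpace V)
    (hV : DirectSum.IsInternal (eigenspaces J K e))
    (hmem : ∀ a, blockFamily q p₁ p₂ a ∈ eigenspaces J K e (blockOf a))
    (hq : ∀ i, IsUnitaryFrame J (q i)) (hp₁ : IsUnitaryFrame J p₁)
    (hp₂ : IsUnitaryFrame J p₂) : IsUnitaryFrame J (blockFamily q p₁ p₂) := by
  have hJmem : ∀ a, J (blockFamily q p₁ p₂ a) ∈ eigenspaces J K e (blockOf a) := fun a =>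
    mem_eigenspaces_iff.2 (apply_left_mem_eigenspace hJ (mem_eigenspaces_iff.1 (hmem a)))
  have hinner : ∀ a b, blockOf a ≠ blockOf b →
      ⟪blockFamily q p₁ p₂ a, blockFamily q p₁ p₂ b⟫_ℝ = 0 := fun a b hab =>
    Submodule.isOrtho_iff_inner_eq.1 (isOrtho_eigenspaces hJ hK hV hab) _ (hmem a) _ (hmem b)
  have hinnerJ : ∀ a b, blockOf a ≠ blockOf b →
      ⟪blockFamily q p₁ p₂ a, J (blockFamily q p₁ p₂ b)⟫_ℝ = 0 := fun a b hab =>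
    Submodule.isOrtho_iff_inner_eq.1 (isOrtho_eigenspaces hJ hK hV hab) _ (hmem a) _ (hJmem b)
  have hinl : ∀ {i j : Fin l}, i ≠ j → (.inl i : Fin l ⊕ Fin 2) ≠ .inl j := Sum.inl_injective.ne
  refine .sumElim
    (.sigma hq (fun i j hij a b => hinner (.inl ⟨i, a⟩) (.inl ⟨j, b⟩) (hinl hij))
      fun i j hij a b => hinnerJ (.inl ⟨i, a⟩) (.inl ⟨j, b⟩) (hinl hij))
    (.sumElim hp₁ hp₂ (fun a b => hinner (.inr (.inl a)) (.inr (.inr b)) (by simp [blockOf]))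
      (fun a b => hinnerJ (.inr (.inl a)) (.inr (.inr b)) (by simp [blockOf]))
      fun b a => hinnerJ (.inr (.inr b)) (.inr (.inl a)) (by simp [blockOf]))
    (fun a b => ?_) (fun a b => ?_) fun b a => ?_
  · exact hinner (.inl a) (.inr b) (by rcases b with _ | _ <;> simp [blockOf])
  · exact hinnerJ (.inl a) (.inr b) (by rcases b with _ | _ <;> simp [blockOf])
  · exact hinnerJ (.inr b) (.inl a) (by rcases b with _ | _ <;> simp [blockOf])

theorem blockFamily_apply_add_smul (hJ : J ∈ twistorSpace V) (hK : K ∈ twistorSpace V)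
    (he : ∀ i, e i ∈ Set.Ioo (-1 : ℝ) 1)
    (hinl : ∀ i x, anticommutingPartner J K (e i) (q i (.inl x)) = q i (.inr x))
    (hinr : ∀ i x, anticommutingPartner J K (e i) (q i (.inr x)) = -q i (.inl x))
    (hp₁ : ∀ a, p₁ a ∈ eigenspace J K 1) (hp₂ : ∀ a, p₂ a ∈ eigenspace J K (-1)) :
    ∀ a, K (blockFamily q p₁ p₂ a) + eigenvalues e (blockOf a) • J (blockFamily q p₁ p₂ a) =
      frameMap J (blockFamily q p₁ p₂) ((quaternionMatrix fun i => √(1 - e i ^ 2)).col a) := by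
  rintro (⟨i, x | x⟩ | a | a)
  · rw [quaternionMatrix_col_inl_inl, map_smul, frameMap_single]
    exact (apply_add_smul_apply_eq (he i) _).trans (congrArg _ (hinl i x))
  · rw [quaternionMatrix_col_inl_inr, map_neg, map_smul, frameMap_single, ← smul_neg]
    exact (apply_add_smul_apply_eq (he i) _).trans (congrArg _ (hinr i x))
  · rw [quaternionMatrix_col_inr, map_zero]
    exact add_eq_zero_iff_eq_neg.2
      (apply_eq_neg_smul_of_mem_eigenspace hJ hK (one_pow 2) (hp₁ a))
  · rw [quaternionMatrix_col_inr, map_zero]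
    exact add_eq_zero_iff_eq_neg.2
      (apply_eq_neg_smul_of_mem_eigenspace hJ hK neg_one_sq (hp₂ a))

end Assembly

theorem exists_isAdaptedFrame [FiniteDimensional ℝ V] (hJ : J ∈ twistorSpace V)
    (hK : K ∈ twistorSpace V) (he : ∀ i, e i ∈ Set.Ioo (-1 : ℝ) 1)
    (hV : DirectSum.IsInternal (eigenspaces J K e))
    (hk : ∀ i, finrank ℝ (eigenspace J K (e i)) = 4 * k i)
    (hm₁ : finrank ℝ (eigenspace J K 1) = 2 * m₁)
    (hm₂ : finrank ℝ (eigenspace J K (-1)) = 2 * m₂) :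
    ∃ v : BlockIndex k m₁ m₂ → V, IsAdaptedFrame J K e v := by
  choose q hqmem hq hinl hinr using fun i => exists_quaternionicFrame
    (isComplexStructureOn_eigenspace hJ) (isComplexStructureOn_anticommutingPartner hJ hK (he i))
    (fun _ => anticommutingPartner_apply_apply_left hJ) (hk i)
  obtain ⟨p₁, hp₁mem, hp₁⟩ := exists_unitaryFrame (isComplexStructureOn_eigenspace hJ) hm₁
  obtain ⟨p₂, hp₂mem, hp₂⟩ := exists_unitaryFrame (isComplexStructureOn_eigenspace hJ) hm₂
  have hmem := blockFamily_mem_eigenspaces hqmem hp₁mem hp₂mem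
  exact ⟨blockFamily q p₁ p₂, isUnitaryFrame_blockFamily hJ hK hV hmem hq hp₁ hp₂, hmem,
    blockFamily_apply_add_smul hJ hK he hinl hinr hp₁mem hp₂mem⟩

namespace IsAdaptedFrame

variable {v : BlockIndex k m₁ m₂ → V}

theorem eigenvalues_ne_iff (hv : IsAdaptedFrame J K e v) (hJ : J ∈ twistorSpace V)
    (hK : K ∈ twistorSpace V) (hV : DirectSum.IsInternal (eigenspaces J K e))
    {a b : BlockIndex k m₁ m₂} :
    eigenvalues e (blockOf a) ≠ eigenvalues e (blockOf b) ↔ blockOf a ≠ blockOf b := by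
  refine ⟨ne_of_apply_ne _, fun hab h => hv.isUnitaryFrame.1.ne_zero b ?_⟩
  have hmem := hv.mem_eigenspaces b
  have hortho := isOrtho_eigenspaces hJ hK hV hab
  rw [eigenspaces_eq_eigenspace, h, ← eigenspaces_eq_eigenspace] at hortho
  exact inner_self_eq_zero.1 (Submodule.isOrtho_iff_inner_eq.1 hortho _ hmem _ hmem)

theorem mem_blockSubgroup_iff [FiniteDimensional ℝ V] {n : ℕ} (hv : IsAdaptedFrame J K e v)
    (hJ : J ∈ twistorSpace V) (hK : K ∈ twistorSpace V) (he : ∀ i, e i ∈ Set.Ioo (-1 : ℝ) 1)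
    (hV : DirectSum.IsInternal (eigenspaces J K e))
    (ε : BlockIndex k m₁ m₂ ≃ Fin n) (hn : finrank ℝ V = 2 * Fintype.card (Fin n))
    (g : Matrix.unitaryGroup (Fin n) ℂ) :
    g ∈ blockSubgroup ε ↔
      Commute (matrixHom hJ (hv.isUnitaryFrame.comp ε.symm.injective) hn g) K := by
  have hcard : finrank ℝ V = 2 * Fintype.card (BlockIndex k m₁ m₂) := by
    rw [hn, Fintype.card_congr ε]
  rw [Twistor.mem_blockSubgroup_iff ε fun i => (sqrt_one_sub_sq_pos (he i)).ne',
    matrixHom_comp_equiv hJ hv.isUnitaryFrame hcard ε.symm, Equiv.symm_symm,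
    commute_matrixHom_iff hJ hv.isUnitaryFrame hcard
      (fun a => mem_eigenspaces_iff.1 (hv.mem_eigenspaces a)) hv.apply_add_smul]
  simp only [hv.eigenvalues_ne_iff hJ hK hV]

end IsAdaptedFrame

end AdaptedFrames

end Twistor

theorem theorem7p2 {V : Type*} [NormedAddCommGroup V] [InnerProductSpace ℝ V]
    [FiniteDimensional ℝ V] (n : ℕ) (hn : Module.finrank ℝ V = 2 * n)
    (J K : V →L[ℝ] V) (hJ : J ∈ Twistor.twistorSpace V) (hK : K ∈ Twistor.twistorSpace V)
    (l : ℕ) (e : Fin l → ℝ) (he : ∀ i, e i ∈ Set.Ioo (-1 : ℝ) 1)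
    (hV : DirectSum.IsInternal (Twistor.eigenspaces J K e))
    (k : Fin l → ℕ) (hk : ∀ i, Module.finrank ℝ (Twistor.eigenspace J K (e i)) = 4 * k i)
    (m₁ m₂ : ℕ) (hm₁ : Module.finrank ℝ (Twistor.eigenspace J K 1) = 2 * m₁)
    (hm₂ : Module.finrank ℝ (Twistor.eigenspace J K (-1)) = 2 * m₂) :
    ∃ ε : Twistor.BlockIndex k m₁ m₂ ≃ Fin n,
    -- the smooth structures of `U(n)`, of the homogeneous space and of the orbit
    ∃ (c d : ℕ)
      (_ : ChartedSpace (EuclideanSpace ℝ (Fin c)) (Matrix.unitaryGroup (Fin n) ℂ))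
      (_ : ChartedSpace (EuclideanSpace ℝ (Fin d))
        (Matrix.unitaryGroup (Fin n) ℂ ⧸ Twistor.blockSubgroup ε))
      (_ : ChartedSpace (EuclideanSpace ℝ (Fin d)) (Twistor.orbit J K)),
      Twistor.IsEmbeddedSubmanifold c
        (Subtype.val : Matrix.unitaryGroup (Fin n) ℂ → Matrix (Fin n) (Fin n) ℂ) ∧
      Twistor.IsQuotientManifold c (Twistor.blockSubgroup ε) d ∧
      Twistor.IsEmbeddedSubmanifold d (Subtype.val : Twistor.orbit J K → V →L[ℝ] V) ∧
      -- an isomorphism of topological groups `U(n) ≅ U(J)` and an equivariant diffeomorphism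
      ∃ (θ : Matrix.unitaryGroup (Fin n) ℂ ≃ₜ* Twistor.unitaryOf J)
        (Φ : (Matrix.unitaryGroup (Fin n) ℂ ⧸ Twistor.blockSubgroup ε)
          ≃ₘ⟮𝓡 d, 𝓡 d⟯ Twistor.orbit J K),
        ∀ g : Matrix.unitaryGroup (Fin n) ℂ,
          (Φ (QuotientGroup.mk g) : V →L[ℝ] V) =
            ((θ g : (V →L[ℝ] V)ˣ) : V →L[ℝ] V) * K * ((θ g : (V →L[ℝ] V)ˣ)⁻¹ : (V →L[ℝ] V)ˣ) := by
  have hn' : Module.finrank ℝ V = 2 * Fintype.card (Fin n) := by rw [hn, Fintype.card_fin]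
  have hcard := Twistor.finrank_eq_two_mul_card_blockIndex hV hk hm₁ hm₂
  let ε : Twistor.BlockIndex k m₁ m₂ ≃ Fin n := Fintype.equivFinOfCardEq (by omega)
  obtain ⟨v, hv⟩ := Twistor.exists_isAdaptedFrame hJ hK he hV hk hm₁ hm₂
  have hu := hv.isUnitaryFrame.comp ε.symm.injective
  obtain ⟨c, d, cU, cQ, cO, hU, hQ, hO, Φ, hΦ⟩ :=
    Twistor.exists_smoothStructure_orbit_unitaryOf hJ hu hn'
      (hv.mem_blockSubgroup_iff hJ hK he hV ε hn')
  exact ⟨ε, c, d, cU, cQ, cO, hU, hQ, hO, Twistor.unitaryEquiv hJ hu hn', Φ, hΦ⟩
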